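/- Let $p=\{p_x\}_{x\in\mathbb N}$, $\mathbb N=\{0,1,2,\dots\}$, be a decreasing probability mass function: $p_x\ge p_{x+1}\ge 0$ and $\sum_x p_x=1$. Let $Y=\{Y_x\}_{x\in\mathbb N}$ be a Gaussian process with mean zero and $\mathrm{Cov}(Y_x,Y_z)=p_x\delta_{x,z}-p_xp_z$ (its paths are almost surely in $\ell_2$). For a vector $w=(w_0,\dots,w_k)$ let $\mathrm{gren}(w)$ be the vector of the $k+1$ slopes of the least concave majorant of the points $(j,\sum_{i=0}^{j}w_i)$, $j=-1,0,\dots,k$, where the empty sum is $0$. Define $Y^G$ by $(Y^G_r,\dots,Y^G_s)=\mathrm{gren}(Y_r,\dots,Y_s)$ for every maximal finite interval $\{r,\dots,s\}$ on which $p$ is constant, and $Y^G_x=Y_x$ at every $x$ that lies in no such finite interval (then $p_x=0$ and $Y_x=0$ almost surely). Write $p$ in terms of its intervals of constancy: $p_x=\theta_i$ for $x\in C_i$, where the nonempty sets $C_1,C_2,\dots$ (finitely or infinitely many) form a partition of $\mathbb N$ and $\theta_i>\theta_{i+1}$ for all $i$. Then: 1. Almost surely $\sum_{x\ge0}(Y^G_x)^2<\infty$,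 this sum is integrable, and $$E\Big[\sum_{x\ge 0}(Y^G_x)^2\Big]=\sum_{i\ge1}\sum_{j=1}^{|C_i|}\theta_i\Big(\frac1j-\theta_i\Big).$$ (If $C_i$ is infinite then $\theta_i=0$ and its term is $0$.) 2. If $\kappa=\max\{x:p_x>0\}$ exists, i.e. the support is finite, then $\sum_{x=0}^\kappa (Y^G_x)^2/p_x$ is integrable and $$E\Big[\sum_{x=0}^{\kappa}\frac{(Y^G_x)^2}{p_x}\Big]=\sum_{i\,:\,\theta_i>0}\ \sum_{j=1}^{|C_i|}\Big(\frac1j-\theta_i\Big).$$ 3. For $y\in\mathbb N$ let $p$ be the uniform mass function on $\{0,\dots,y\}$, let $\widehat p_n$ be the empirical mass function of an i.i.d. sample $X_1,\dots,X_n$ from $p$, and let $\widehat p_n^{\,G}$ be the maximum likelihood (Grenander) estimator of a decreasing mass function, that is, $\mathrm{gren}(\widehat p_{n,0},\dots,\widehat p_{n,M})$ with $M=\max_i X_i$, extended by zero. Then $$\lim_{n\to\infty} n\,E\Big[\sum_{x\ge0}(\widehat p^{\,G}_{n,x}-p_x)^2\Big]=E\Big[\sum_{x\ge0}(Y^G_x)^2\Big]=a_y:=\frac1{y+1}\sum_{i=1}^{y}\frac1{i+1},$$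 and $a_y\sim (\log y)/(y+1)$ as $y\to\infty$. -/

import Mathlib

open MeasureTheory ProbabilityTheory Filter Topology Asymptotics

noncomputable section

/-- `p` is a decreasing probability mass function on `ℕ`. -/
structure IsDecreasingPMF (p : ℕ → ℝ) : Prop where
  nonneg : ∀ x, 0 ≤ p x
  hasSum_one : HasSum p 1
  antitone : Antitone p

/-- `p` takes the value `θ i` on `C i`, where the sets `C i`, `i ∈ I`, partition `ℕ` and the
values are strictly decreasing in `i`. The index set `I` is an initial segment of `ℕ`: all of `ℕ`
if `p` takes infinitely many values, and `{0, …, m - 1}` if it takes `m` values. -/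
structure IsConstancyDecomposition (p : ℕ → ℝ) (I : Set ℕ) (C : ℕ → Set ℕ) (θ : ℕ → ℝ) :
    Prop where
  isLowerSet : IsLowerSet I
  nonempty : ∀ i ∈ I, (C i).Nonempty
  disjoint : I.PairwiseDisjoint C
  cover : ⋃ i ∈ I, C i = Set.univ
  value : ∀ i ∈ I, ∀ x ∈ C i, p x = θ i
  strictAnti : ∀ i, i + 1 ∈ I → θ (i + 1) < θ i

/-- `Y` is a centred Gaussian process indexed by `ℕ` with covariance
`Cov(Y_x, Y_z) = p_x δ_{x,z} - p_x p_z`, the limit of the fluctuations of the empirical mass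
function. As `∑ₓ Var(Y_x) = ∑ₓ p_x (1 - p_x)` is finite, its paths are almost surely in `ℓ²`. -/
structure IsLimitProcess {Ω : Type*} [MeasurableSpace Ω] (p : ℕ → ℝ) (Y : ℕ → Ω → ℝ)
    (P : Measure Ω) : Prop where
  gaussian : IsGaussianProcess Y P
  mean : ∀ x, ∫ ω, Y x ω ∂P = 0
  cov : ∀ x z, cov[Y x, Y z; P] = (if x = z then p x else 0) - p x * p z

/-- The least concave majorant on `[0, n]` of the points `(m, S m)`, `m = 0, …, n`: the pointwise
infimum of all functions that are concave on `[0, n]` and lie above these points. -/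
def leastConcaveMajorant (n : ℕ) (S : ℕ → ℝ) (t : ℝ) : ℝ :=
  sInf {v : ℝ | ∃ g : ℝ → ℝ, ConcaveOn ℝ (Set.Icc (0 : ℝ) n) g ∧
    (∀ m : ℕ, m ≤ n → S m ≤ g m) ∧ v = g t}

/-- The operator `gren`, applied to the vector `(w 0, …, w (n - 1))`: its `j`-th entry, `j < n`, is
the slope between `j` and `j + 1` of the least concave majorant of the partial sums
`(m, w 0 + ⋯ + w (m - 1))`, `m = 0, …, n` (which is linear there). -/
def gren (n : ℕ) (w : ℕ → ℝ) (j : ℕ) : ℝ :=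
  leastConcaveMajorant n (fun m ↦ ∑ i ∈ Finset.range m, w i) ((j : ℝ) + 1) -
    leastConcaveMajorant n (fun m ↦ ∑ i ∈ Finset.range m, w i) (j : ℝ)

/-- The period of constancy of `p` that contains `x`; it is an interval when `p` is monotone. -/
def constancyPeriod (p : ℕ → ℝ) (x : ℕ) : Set ℕ := {z | p z = p x}

open Classical in
/-- The transform `y ↦ y^G` of a path `y`: on each finite period of constancy `{r, …, s}` of `p`
the vector `(y r, …, y s)` is replaced by its image under `gren`. An infinite period of constancy
(the set of zeros of `p`, if there are any) is left unchanged. -/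
def grenTransform (p : ℕ → ℝ) (y : ℕ → ℝ) (x : ℕ) : ℝ :=
  if (constancyPeriod p x).Finite then
    gren (sSup (constancyPeriod p x) + 1 - sInf (constancyPeriod p x))
      (fun i ↦ y (sInf (constancyPeriod p x) + i)) (x - sInf (constancyPeriod p x))
  else y x

/-- The uniform mass function on `{0, …, y}`. -/
def uniformMass (y : ℕ) (x : ℕ) : ℝ := if x ≤ y then 1 / ((y : ℝ) + 1) else 0

/-- The empirical mass function of a sample of size `n`. -/
def empiricalMass {n : ℕ} (X : Fin n → ℕ) (x : ℕ) : ℝ :=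
  (∑ i, if X i = x then (1 : ℝ) else 0) / n

/-- The maximum likelihood (Grenander) estimator of a decreasing mass function: `gren` of the
empirical mass function on `{0, …, max X_i}`, and zero beyond. -/
def grenanderEstimator {n : ℕ} (X : Fin n → ℕ) (x : ℕ) : ℝ :=
  if x ≤ Finset.univ.sup X then gren (Finset.univ.sup X + 1) (empiricalMass X) x else 0

/-- The distribution on `ℕ` with mass function `p`. -/
def massLaw (p : ℕ → ℝ) : Measure ℕ :=
  Measure.sum fun x ↦ ENNReal.ofReal (p x) • Measure.dirac x

/-- The `ℓ²` risk `E_p ∑ₓ (p̂ₙ,ₓ - pₓ)²` of the Grenander estimator for an i.i.d. sample of size `n`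
from `p`. -/
def grenanderRisk (p : ℕ → ℝ) (n : ℕ) : ℝ :=
  ∫ X : Fin n → ℕ, ∑' x, (grenanderEstimator X x - p x) ^ 2 ∂Measure.pi fun _ ↦ massLaw p

end

/-! ### Least concave majorants at integer points -/

section LeastConcaveMajorant

variable {n : ℕ} {S S' : ℕ → ℝ}

/-! Fix a level t. The entries of gren(w) decrease, so their excesses over t add up to the largest
value of (majorant at m) − tm. A line of slope t lies above the majorant as soon as it lies above
the points, so this is the maximum of the partial sums of w − t (`sum_max_gren_sub`).

Averaged over all permutations of w, Kac's identity (`sum_perm_maxSum`) turns that maximum into the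
sum over j of (S_j − jt)⁺/j = (S_j/j − t)⁺, where S_j is the j-th partial sum. Hence, over all
permutations together, the entries of gren and the running means S_j/j have the same total excess
above every level. Integrating over t gives equal sums of squares (`sum_perm_gren_sq`). For an
exchangeable vector, therefore, E‖gren‖² = ∑ E(S_j/j)², which involves only second moments of
partial sums.

On a period of constancy with value θ the limit process is exchangeable and Var S_j = jθ − (jθ)², so
the j-th running mean contributes θ(1/j − θ). The periods are added up by Tonelli, with ∑ p as a
bound.

For a uniform law the centred empirical mass function is itself exchangeable, with the same second
moments divided by n. The scaled risk thus equals a_y exactly for every n ≥ 1, and no limit theorem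
is needed. -/

theorem leastConcaveMajorant_set_bddBelow (n : ℕ) (S : ℕ → ℝ) {m : ℕ} (hm : m ≤ n) :
    BddBelow {v : ℝ | ∃ g : ℝ → ℝ, ConcaveOn ℝ (Set.Icc (0 : ℝ) n) g ∧
      (∀ m : ℕ, m ≤ n → S m ≤ g m) ∧ v = g m} :=
  ⟨S m, by rintro v ⟨g, -, h, rfl⟩; exact h m hm⟩

theorem leastConcaveMajorant_set_nonempty (n : ℕ) (S : ℕ → ℝ) (t : ℝ) :
    {v : ℝ | ∃ g : ℝ → ℝ, ConcaveOn ℝ (Set.Icc (0 : ℝ) n) g ∧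
      (∀ m : ℕ, m ≤ n → S m ≤ g m) ∧ v = g t}.Nonempty := by
  refine ⟨_, fun _ ↦ ∑ i ∈ Finset.range (n + 1), |S i|, concaveOn_const _ (convex_Icc _ _),
    fun m hm ↦ (le_abs_self _).trans ?_, rfl⟩
  exact Finset.single_le_sum (f := fun i ↦ |S i|) (fun i _ ↦ abs_nonneg _)
    (Finset.mem_range.2 (by omega))

theorem le_leastConcaveMajorant {m : ℕ} (hm : m ≤ n) : S m ≤ leastConcaveMajorant n S m :=
  le_csInf (leastConcaveMajorant_set_nonempty n S m)
    (by rintro v ⟨g, -, h, rfl⟩; exact h m hm)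

theorem leastConcaveMajorant_le {g : ℝ → ℝ} (hg : ConcaveOn ℝ (Set.Icc (0 : ℝ) n) g)
    (h : ∀ m : ℕ, m ≤ n → S m ≤ g m) {m : ℕ} (hm : m ≤ n) :
    leastConcaveMajorant n S m ≤ g m :=
  csInf_le (leastConcaveMajorant_set_bddBelow n S hm) ⟨g, hg, h, rfl⟩

theorem leastConcaveMajorant_le_affine {a b : ℝ} (h : ∀ m : ℕ, m ≤ n → S m ≤ a + b * m) {m : ℕ}
    (hm : m ≤ n) : leastConcaveMajorant n S m ≤ a + b * m := by
  refine leastConcaveMajorant_le (g := fun t ↦ a + b * t) ?_ h hm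
  refine ⟨convex_Icc _ _, fun x _ y _ s t _ _ hst ↦ le_of_eq ?_⟩
  simp only [smul_eq_mul]
  linear_combination a * hst

/-- An infimum of concave functions is concave. Three consecutive integers suffice to make the
slopes decrease. -/
theorem leastConcaveMajorant_midpoint {m : ℕ} (hm : m + 2 ≤ n) :
    leastConcaveMajorant n S m + leastConcaveMajorant n S (m + 2 : ℕ) ≤
      2 * leastConcaveMajorant n S (m + 1 : ℕ) := by
  have key : (leastConcaveMajorant n S m + leastConcaveMajorant n S (m + 2 : ℕ)) / 2 ≤
      leastConcaveMajorant n S (m + 1 : ℕ) := by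
    refine le_csInf (leastConcaveMajorant_set_nonempty n S _) ?_
    rintro v ⟨g, hg, h, rfl⟩
    have h1 := leastConcaveMajorant_le hg h (m := m) (by omega)
    have h2 := leastConcaveMajorant_le hg h hm
    have hn : ((m + 2 : ℕ) : ℝ) ≤ n := by exact_mod_cast hm
    push_cast at hn
    have h0 := hg.2
    have h3 := @h0 (m : ℝ)
      ⟨by positivity, by linarith⟩ ((m + 2 : ℕ) : ℝ)
      ⟨by positivity, by push_cast; linarith⟩ (1 / 2) (1 / 2) (by norm_num) (by norm_num)
      (by norm_num)
    simp only [smul_eq_mul] at h3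
    have h4 : (1 / 2 : ℝ) * m + 1 / 2 * ((m + 2 : ℕ) : ℝ) = ((m + 1 : ℕ) : ℝ) := by
      push_cast; ring
    rw [h4] at h3
    linarith
  linarith

/-- A steep enough line through the first point lies above all the others, because they are at
distance at least 1 from it. The last point is treated symmetrically in `leastConcaveMajorant_self`.
-/
theorem leastConcaveMajorant_zero : leastConcaveMajorant n S (0 : ℕ) = S 0 := by
  refine le_antisymm ?_ (le_leastConcaveMajorant (Nat.zero_le n))
  set B := ∑ i ∈ Finset.range (n + 1), |S i - S 0|
  have := leastConcaveMajorant_le_affine (n := n) (S := S) (a := S 0) (b := B) ?_ (Nat.zero_le n)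
  · simpa using this
  · intro m hm
    rcases Nat.eq_zero_or_pos m with rfl | h0
    · simp
    have h1 : |S m - S 0| ≤ B := Finset.single_le_sum (f := fun i ↦ |S i - S 0|)
      (fun i _ ↦ abs_nonneg _) (Finset.mem_range.2 (by omega))
    have h2 : (1 : ℝ) ≤ m := by exact_mod_cast h0
    have h3 := le_abs_self (S m - S 0)
    nlinarith [abs_nonneg (S m - S 0)]

theorem leastConcaveMajorant_self : leastConcaveMajorant n S (n : ℕ) = S n := by
  refine le_antisymm ?_ (le_leastConcaveMajorant le_rfl)
  set B := ∑ i ∈ Finset.range (n + 1), |S i - S n|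
  have := leastConcaveMajorant_le_affine (n := n) (S := S) (a := S n + B * n) (b := -B) ?_ le_rfl
  · simpa using this
  · intro m hm
    rcases hm.eq_or_lt with rfl | h0
    · simp
    have h1 : |S m - S n| ≤ B := Finset.single_le_sum (f := fun i ↦ |S i - S n|)
      (fun i _ ↦ abs_nonneg _) (Finset.mem_range.2 (by omega))
    have h2 : (m : ℝ) + 1 ≤ n := by exact_mod_cast h0
    have h3 := le_abs_self (S m - S n)
    nlinarith [abs_nonneg (S m - S n)]

theorem leastConcaveMajorant_le_add {ε : ℝ} (h : ∀ m ≤ n, S m ≤ S' m + ε) {m : ℕ} (hm : m ≤ n) :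
    leastConcaveMajorant n S m ≤ leastConcaveMajorant n S' m + ε := by
  rw [← sub_le_iff_le_add]
  refine le_csInf (leastConcaveMajorant_set_nonempty n S' _) ?_
  rintro v ⟨g, hg, h', rfl⟩
  rw [sub_le_iff_le_add]
  exact leastConcaveMajorant_le (g := fun t ↦ g t + ε) (hg.add_const ε)
    (fun k hk ↦ (h k hk).trans (by linarith [h' k hk])) hm

theorem leastConcaveMajorant_congr (h : ∀ m ≤ n, S m = S' m) (t : ℝ) :
    leastConcaveMajorant n S t = leastConcaveMajorant n S' t := by
  unfold leastConcaveMajorant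
  congr 1
  ext v
  refine exists_congr fun g ↦ and_congr_right fun _ ↦ and_congr_left fun _ ↦
    forall₂_congr fun m hm ↦ ?_
  rw [h m hm]

end LeastConcaveMajorant

/-! ### Slopes of the majorant and maxima of partial sums -/

section Gren

variable {n : ℕ} {w w' : ℕ → ℝ}

theorem gren_congr (h : ∀ i < n, w i = w' i) (j : ℕ) : gren n w j = gren n w' j := by
  have : ∀ m ≤ n, ∑ i ∈ Finset.range m, w i = ∑ i ∈ Finset.range m, w' i := fun m hm ↦
    Finset.sum_congr rfl fun i hi ↦ h i (by have := Finset.mem_range.1 hi; omega)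
  unfold gren
  rw [leastConcaveMajorant_congr this, leastConcaveMajorant_congr this]

theorem gren_eq (n : ℕ) (w : ℕ → ℝ) (j : ℕ) :
    gren n w j = leastConcaveMajorant n (fun m ↦ ∑ i ∈ Finset.range m, w i) (j + 1 : ℕ) -
      leastConcaveMajorant n (fun m ↦ ∑ i ∈ Finset.range m, w i) j := by
  simp [gren]

theorem gren_succ_le {j : ℕ} (hj : j + 1 < n) : gren n w (j + 1) ≤ gren n w j := by
  rw [gren_eq, gren_eq]
  have := leastConcaveMajorant_midpoint (S := fun m ↦ ∑ i ∈ Finset.range m, w i)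
    (show j + 2 ≤ n by omega)
  linarith

theorem gren_antitoneOn {i j : ℕ} (hij : i ≤ j) (hj : j < n) : gren n w j ≤ gren n w i := by
  induction j, hij using Nat.le_induction with
  | base => rfl
  | succ k hk ih => exact (gren_succ_le hj).trans (ih (by omega))

theorem sum_range_gren (n : ℕ) (w : ℕ → ℝ) (m : ℕ) :
    ∑ j ∈ Finset.range m, gren n w j =
      leastConcaveMajorant n (fun m ↦ ∑ i ∈ Finset.range m, w i) m := by
  simp_rw [gren_eq]
  rw [Finset.sum_range_sub (fun m : ℕ ↦
    leastConcaveMajorant n (fun m ↦ ∑ i ∈ Finset.range m, w i) (m : ℝ)) m,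
    leastConcaveMajorant_zero]
  simp

/-- The maximum of the partial sums `x 0 + ⋯ + x (m - 1)`, `m = 0, …, n`. -/
noncomputable def maxSum (x : ℕ → ℝ) : ℕ → ℝ
  | 0 => 0
  | n + 1 => max (maxSum x n) (∑ i ∈ Finset.range (n + 1), x i)

theorem le_maxSum (x : ℕ → ℝ) {m n : ℕ} (h : m ≤ n) :
    ∑ i ∈ Finset.range m, x i ≤ maxSum x n := by
  induction n with
  | zero => simp [maxSum, Nat.le_zero.1 h]
  | succ n ih =>
    rcases h.eq_or_lt with rfl | h
    · exact le_max_right _ _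
    · exact (ih (by omega)).trans (le_max_left _ _)

theorem maxSum_le {x : ℕ → ℝ} {n : ℕ} {c : ℝ}
    (h : ∀ m ≤ n, ∑ i ∈ Finset.range m, x i ≤ c) : maxSum x n ≤ c := by
  induction n with
  | zero => simpa [maxSum] using h 0 le_rfl
  | succ n ih => exact max_le (ih fun m hm ↦ h m (by omega)) (h _ le_rfl)

theorem maxSum_succ' (x : ℕ → ℝ) (n : ℕ) :
    maxSum x (n + 1) = max 0 (x 0 + maxSum (fun i ↦ x (i + 1)) n) := by
  induction n with
  | zero => simp [maxSum]
  | succ n ih =>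
    rw [maxSum, ih, Finset.sum_range_succ', maxSum, max_assoc, ← max_add_add_left]
    congr 2
    ring

theorem maxSum_congr {x x' : ℕ → ℝ} {n : ℕ} (h : ∀ i < n, x i = x' i) :
    maxSum x n = maxSum x' n := by
  induction n with
  | zero => rfl
  | succ n ih =>
    rw [maxSum, maxSum, ih fun i hi ↦ h i (by omega)]
    congr 1
    exact Finset.sum_congr rfl fun i hi ↦ h i (Finset.mem_range.1 hi)

/-- Conjugate duality: a set of points and its concave majorant have the same supporting line of
slope t. -/
theorem sum_max_gren_sub (n : ℕ) (w : ℕ → ℝ) (t : ℝ) :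
    ∑ j ∈ Finset.range n, max (gren n w j - t) 0 = maxSum (fun i ↦ w i - t) n := by
  have hS : ∀ (u : ℕ → ℝ) (m : ℕ), ∑ i ∈ Finset.range m, (u i - t) =
      ∑ i ∈ Finset.range m, u i - t * m := by
    intro u m; rw [Finset.sum_sub_distrib]; simp [mul_comm]
  apply le_antisymm
  -- The entries decrease, so those above t form an initial segment, of length r.
  · obtain ⟨r, hr, h⟩ : ∃ r ≤ n, ∑ j ∈ Finset.range n, max (gren n w j - t) 0 =
        ∑ j ∈ Finset.range r, (gren n w j - t) := by
      have : ∀ k ≤ n, ∃ r ≤ k, ∑ j ∈ Finset.range k, max (gren n w j - t) 0 =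
        ∑ j ∈ Finset.range r, (gren n w j - t) := by
        intro k
        induction k with
        | zero => exact fun _ ↦ ⟨0, le_rfl, by simp⟩
        | succ k ih =>
          intro hk
          rcases le_total (gren n w k) t with h | h
          · obtain ⟨r, hr, h'⟩ := ih (by omega)
            exact ⟨r, by omega, by
              rw [Finset.sum_range_succ, h', max_eq_right (by linarith), add_zero]⟩
          · refine ⟨k + 1, le_rfl, Finset.sum_congr rfl fun j hj ↦ max_eq_left ?_⟩
            have := gren_antitoneOn (w := w) (i := j) (j := k) (n := n)
              (by have := Finset.mem_range.1 hj; omega) (by omega)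
            linarith
      exact this n le_rfl
    rw [h, hS, sum_range_gren, sub_le_iff_le_add]
    -- The line of slope t with intercept `maxSum` lies above every point, hence above the majorant
    -- at r.
    refine leastConcaveMajorant_le_affine (fun m hm ↦ ?_) hr
    rw [← sub_le_iff_le_add, ← hS]
    exact le_maxSum (fun i ↦ w i - t) hm
  · refine maxSum_le fun m hm ↦ ?_
    rw [hS]
    calc ∑ i ∈ Finset.range m, w i - t * m
        ≤ ∑ j ∈ Finset.range m, gren n w j - t * m := by
          rw [sum_range_gren]
          gcongr
          exact le_leastConcaveMajorant (S := fun m ↦ ∑ i ∈ Finset.range m, w i) hm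
      _ = ∑ j ∈ Finset.range m, (gren n w j - t) := (hS _ _).symm
      _ ≤ ∑ j ∈ Finset.range m, max (gren n w j - t) 0 :=
          Finset.sum_le_sum fun _ _ ↦ le_max_left _ _
      _ ≤ ∑ j ∈ Finset.range n, max (gren n w j - t) 0 :=
          Finset.sum_le_sum_of_subset_of_nonneg (Finset.range_mono hm)
            fun _ _ _ ↦ le_max_right _ _

/-- `gren` commutes with the addition of a constant. -/
theorem gren_sub_const (n : ℕ) (w : ℕ → ℝ) (c : ℝ) {j : ℕ} (hj : j < n) :
    gren n (fun i ↦ w i - c) j = gren n w j - c := by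
  have key : ∀ (u : ℕ → ℝ) (d : ℝ) (m : ℕ), m ≤ n →
      leastConcaveMajorant n (fun m ↦ ∑ i ∈ Finset.range m, (u i - d)) m ≤
      leastConcaveMajorant n (fun m ↦ ∑ i ∈ Finset.range m, u i) m - d * m := by
    intro u d m hm
    rw [le_sub_iff_add_le]
    refine le_csInf (leastConcaveMajorant_set_nonempty n _ _) ?_
    rintro v ⟨g, hg, h, rfl⟩
    rw [← le_sub_iff_add_le]
    refine leastConcaveMajorant_le (g := fun t ↦ g t - d * t) (hg.sub ?_) (fun k hk ↦ ?_) hm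
    · refine ⟨convex_Icc _ _, fun x _ y _ s t _ _ _ ↦ le_of_eq ?_⟩
      simp only [smul_eq_mul]; ring
    · have := h k hk
      rw [Finset.sum_sub_distrib]
      simp only [Finset.sum_const, Finset.card_range, nsmul_eq_mul]
      linarith
  have key' : ∀ m ≤ n, leastConcaveMajorant n (fun m ↦ ∑ i ∈ Finset.range m, (w i - c)) m =
      leastConcaveMajorant n (fun m ↦ ∑ i ∈ Finset.range m, w i) m - c * m := by
    intro m hm
    refine le_antisymm (key w c m hm) ?_
    -- Undoing the shift, that is, shifting by `-c`, gives the reverse inequality.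
    have := key (fun i ↦ w i - c) (-c) m hm
    simp only [sub_neg_eq_add, sub_add_cancel] at this
    linarith
  rw [gren_eq, gren_eq, key' _ (by omega), key' _ (by omega)]
  push_cast
  ring

/-- The majorant at an integer is 1-Lipschitz for the ℓ¹ distance of the first n coordinates.
Continuity serves to prove measurability. -/
theorem continuous_gren (n : ℕ) {j : ℕ} (hj : j < n) : Continuous fun w : ℕ → ℝ ↦ gren n w j := by
  have key : ∀ m ≤ n, Continuous fun w : ℕ → ℝ ↦
      leastConcaveMajorant n (fun m ↦ ∑ i ∈ Finset.range m, w i) (m : ℝ) := by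
    intro m hm
    rw [continuous_iff_continuousAt]
    intro w
    have hb : ∀ w' : ℕ → ℝ,
        |leastConcaveMajorant n (fun m ↦ ∑ i ∈ Finset.range m, w' i) m -
          leastConcaveMajorant n (fun m ↦ ∑ i ∈ Finset.range m, w i) m| ≤
          ∑ i ∈ Finset.range n, |w' i - w i| := by
      intro w'
      have hd : ∀ k ≤ n, |∑ i ∈ Finset.range k, w' i - ∑ i ∈ Finset.range k, w i| ≤
          ∑ i ∈ Finset.range n, |w' i - w i| := by
        intro k hk
        rw [← Finset.sum_sub_distrib]
        exact (Finset.abs_sum_le_sum_abs _ _).trans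
          (Finset.sum_le_sum_of_subset_of_nonneg (Finset.range_mono hk) fun _ _ _ ↦ abs_nonneg _)
      rw [abs_sub_le_iff]
      constructor
      · rw [sub_le_iff_le_add']
        exact leastConcaveMajorant_le_add
          (fun k hk ↦ by linarith [(abs_sub_le_iff.1 (hd k hk)).1]) hm
      · rw [sub_le_iff_le_add']
        exact leastConcaveMajorant_le_add
          (fun k hk ↦ by linarith [(abs_sub_le_iff.1 (hd k hk)).2]) hm
    rw [ContinuousAt, tendsto_iff_dist_tendsto_zero]
    refine squeeze_zero (fun _ ↦ dist_nonneg) hb ?_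
    have : Continuous fun w' : ℕ → ℝ ↦ ∑ i ∈ Finset.range n, |w' i - w i| := by fun_prop
    simpa using this.tendsto w
  simp_rw [gren_eq]
  exact (key _ (by omega)).sub (key _ (by omega))

end Gren

/-! ### Kac's identity, averaged over permutations -/

section Permutations

/-- The permutations of `ℕ` that fix every `i ≥ n`. -/
abbrev PermBelow (n : ℕ) : Type := {σ : Equiv.Perm ℕ // ∀ i, ¬ i < n → σ i = i}

noncomputable instance (n : ℕ) : Fintype (PermBelow n) :=
  haveI := Fintype.ofFinite (Equiv.Perm {i // i < n})
  Fintype.ofEquiv (Equiv.Perm {i // i < n}) (Equiv.Perm.subtypeEquivSubtypePerm _)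

theorem PermBelow.apply_lt {n : ℕ} (σ : PermBelow n) {i : ℕ} (hi : i < n) : σ.1 i < n := by
  by_contra h
  have := σ.1.injective (σ.2 _ h)
  omega

theorem PermBelow.sum_mul_right {n : ℕ} (F : (ℕ → ℝ) → ℝ) (x : ℕ → ℝ) (τ : Equiv.Perm ℕ)
    (hτ : ∀ i, ¬ i < n → τ i = i) :
    ∑ σ : PermBelow n, F (fun i ↦ x (σ.1 (τ i))) = ∑ σ : PermBelow n, F (fun i ↦ x (σ.1 i)) := by
  let e : PermBelow n ≃ PermBelow n :=
    (Equiv.mulRight τ).subtypeEquiv fun σ ↦ by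
      refine forall₂_congr fun i hi ↦ ?_
      simp [hτ i hi]
  exact Fintype.sum_equiv e _ _ fun σ ↦ rfl

/-- The cycle `0 ↦ m`, `i + 1 ↦ i` for `i < m`. -/
def shiftPerm (m : ℕ) : Equiv.Perm ℕ where
  toFun k := if k = 0 then m else if k ≤ m then k - 1 else k
  invFun k := if k < m then k + 1 else if k = m then 0 else k
  left_inv k := by grind
  right_inv k := by grind

theorem sum_range_comp_perm {m : ℕ} (x : ℕ → ℝ) (τ : Equiv.Perm ℕ) (hτ : ∀ i, ¬ i < m → τ i = i) :
    ∑ i ∈ Finset.range m, x (τ i) = ∑ i ∈ Finset.range m, x i := by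
  refine τ.sum_comp _ x fun i hi ↦ ?_
  by_contra h
  exact hi (hτ i (by simpa using h))

/-- If the full sum is positive, the empty sum is not the maximum and the first term can be split
off. Otherwise the full sum can be dropped. Either way a maximum over m terms remains, and the case
distinction is invariant under permutation. -/
theorem maxSum_succ_eq (x : ℕ → ℝ) (m : ℕ) :
    maxSum x (m + 1) = (if 0 < ∑ i ∈ Finset.range (m + 1), x i then x 0 else 0) +
      ((if 0 < ∑ i ∈ Finset.range (m + 1), x i then maxSum (fun i ↦ x (i + 1)) m else 0) +
      (if 0 < ∑ i ∈ Finset.range (m + 1), x i then 0 else maxSum x m)) := by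
  split_ifs with h
  · rw [maxSum_succ', max_eq_right, add_zero]
    have := le_maxSum (fun i ↦ x (i + 1)) (le_refl m)
    rw [Finset.sum_range_succ'] at h
    linarith
  · have h0 : 0 ≤ maxSum x m := by simpa using le_maxSum x (Nat.zero_le m)
    rw [maxSum, max_eq_left (by linarith), zero_add, zero_add]

/-- **Kac's identity** (a form of Spitzer's): the maximum of the partial sums of an exchangeable
vector. -/
theorem sum_perm_maxSum {n : ℕ} (x : ℕ → ℝ) {m : ℕ} (hm : m ≤ n) :
    ∑ σ : PermBelow n, maxSum (fun i ↦ x (σ.1 i)) m =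
      ∑ σ : PermBelow n, ∑ j ∈ Finset.range m,
        max (∑ i ∈ Finset.range (j + 1), x (σ.1 i)) 0 / ((j : ℝ) + 1) := by
  induction m with
  | zero => simp [maxSum]
  | succ m ih =>
    have hfirst : ∑ σ : PermBelow n,
        (if 0 < ∑ i ∈ Finset.range (m + 1), x (σ.1 i) then x (σ.1 0) else 0) =
        ∑ σ : PermBelow n, max (∑ i ∈ Finset.range (m + 1), x (σ.1 i)) 0 / ((m : ℝ) + 1) := by
      -- Swapping 0 and k leaves the full sum unchanged, so on average the first term may be
      -- replaced by the mean of the m + 1 terms.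
      have h1 : ∀ k ∈ Finset.range (m + 1), ∑ σ : PermBelow n,
          (if 0 < ∑ i ∈ Finset.range (m + 1), x (σ.1 i) then x (σ.1 k) else 0) =
          ∑ σ : PermBelow n,
          (if 0 < ∑ i ∈ Finset.range (m + 1), x (σ.1 i) then x (σ.1 0) else 0) := by
        intro k hk
        have hk := Finset.mem_range.1 hk
        have hs : ∀ l, ¬ l < m + 1 → Equiv.swap 0 k l = l := fun l hl ↦
          Equiv.swap_apply_of_ne_of_ne (by omega) (by omega)
        rw [← PermBelow.sum_mul_right (fun y ↦
          if 0 < ∑ i ∈ Finset.range (m + 1), y i then y 0 else 0) x (Equiv.swap 0 k)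
          (fun l hl ↦ hs l (by omega))]
        refine Finset.sum_congr rfl fun σ _ ↦ ?_
        rw [sum_range_comp_perm (fun i ↦ x (σ.1 i)) _ hs]
        simp only [Equiv.swap_apply_left]
      have h2 := Finset.sum_congr rfl h1
      rw [Finset.sum_const, Finset.card_range, nsmul_eq_mul, Finset.sum_comm] at h2
      rw [← Finset.sum_div, eq_div_iff (by positivity), mul_comm]
      push_cast at h2
      rw [← h2]
      refine Finset.sum_congr rfl fun σ _ ↦ ?_
      split_ifs with h
      · rw [max_eq_left h.le]
      · rw [max_eq_right (not_lt.1 h), Finset.sum_const_zero]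
    -- A cyclic rotation preserves the full sum and moves the shifted entries back to the first m
    -- places. The two cases then recombine into `maxSum` over m terms.
    have hshift : ∑ σ : PermBelow n, (if 0 < ∑ i ∈ Finset.range (m + 1), x (σ.1 i) then
          maxSum (fun i ↦ x (σ.1 (i + 1))) m else 0) =
        ∑ σ : PermBelow n, (if 0 < ∑ i ∈ Finset.range (m + 1), x (σ.1 i) then
          maxSum (fun i ↦ x (σ.1 i)) m else 0) := by
      have hs : ∀ l, ¬ l < m + 1 → shiftPerm m l = l := fun l hl ↦ by
        simp only [shiftPerm, Equiv.coe_fn_mk]; split_ifs <;> omega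
      rw [← PermBelow.sum_mul_right (fun y ↦ if 0 < ∑ i ∈ Finset.range (m + 1), y i then
          maxSum (fun i ↦ y (i + 1)) m else 0) x (shiftPerm m) (fun l hl ↦ hs l (by omega))]
      refine Finset.sum_congr rfl fun σ _ ↦ ?_
      rw [sum_range_comp_perm (fun i ↦ x (σ.1 i)) _ hs]
      congr 1
      refine maxSum_congr fun i hi ↦ ?_
      have : shiftPerm m (i + 1) = i := by
        simp only [shiftPerm, Equiv.coe_fn_mk]; grind
      simp only [this]
    calc ∑ σ : PermBelow n, maxSum (fun i ↦ x (σ.1 i)) (m + 1)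
        = _ := Finset.sum_congr rfl fun σ _ ↦ maxSum_succ_eq _ _
      _ = ∑ σ : PermBelow n, max (∑ i ∈ Finset.range (m + 1), x (σ.1 i)) 0 / ((m : ℝ) + 1) +
          ∑ σ : PermBelow n, maxSum (fun i ↦ x (σ.1 i)) m := by
        rw [Finset.sum_add_distrib, Finset.sum_add_distrib, hfirst, hshift,
          ← Finset.sum_add_distrib]
        congr 1
        refine Finset.sum_congr rfl fun σ _ ↦ ?_
        split_ifs <;> simp
      _ = _ := by
        rw [ih (by omega), add_comm, ← Finset.sum_add_distrib]
        exact Finset.sum_congr rfl fun σ _ ↦ (Finset.sum_range_succ _ _).symm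

end Permutations

/-! ### From excesses over levels to sums of squares -/

section PosPart

theorem integral_max_sub_zero {u c : ℝ} (h1 : -c ≤ u) (h2 : u ≤ c) :
    ∫ t in (-c)..c, max (u - t) 0 = (u + c) ^ 2 / 2 := by
  have hc : Continuous fun t : ℝ ↦ max (u - t) 0 := by fun_prop
  rw [← intervalIntegral.integral_add_adjacent_intervals (b := u)
    (hc.intervalIntegrable _ _) (hc.intervalIntegrable _ _)]
  have e1 : ∫ t in (-c)..u, max (u - t) 0 = ∫ t in (-c)..u, (u - t) := by
    refine intervalIntegral.integral_congr fun t ht ↦ ?_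
    rw [Set.uIcc_of_le h1] at ht
    exact max_eq_left (by linarith [ht.2])
  have e2 : ∫ t in u..c, max (u - t) 0 = ∫ t in u..c, (0 : ℝ) := by
    refine intervalIntegral.integral_congr fun t ht ↦ ?_
    rw [Set.uIcc_of_le h2] at ht
    exact max_eq_right (by linarith [ht.1])
  rw [e1, e2, intervalIntegral.integral_sub (by simp) (by simp)]
  simp
  ring

/-- Two families whose positive parts above every level have the same sum have the same sum of
squares. -/
theorem sum_sq_eq_of_sum_max_eq {ι : Type*} (s : Finset ι) (u v : ι → ℝ)
    (h : ∀ t, ∑ i ∈ s, max (u i - t) 0 = ∑ i ∈ s, max (v i - t) 0) :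
    ∑ i ∈ s, u i ^ 2 = ∑ i ∈ s, v i ^ 2 := by
  set c := ∑ i ∈ s, (|u i| + |v i|)
  have hb : ∀ i ∈ s, |u i| + |v i| ≤ c := fun i hi ↦
    Finset.single_le_sum (f := fun i ↦ |u i| + |v i|) (fun i _ ↦ by positivity) hi
  have hu : ∀ i ∈ s, -c ≤ u i ∧ u i ≤ c := fun i hi ↦
    abs_le.1 (by linarith [hb i hi, abs_nonneg (v i)])
  have hv : ∀ i ∈ s, -c ≤ v i ∧ v i ≤ c := fun i hi ↦
    abs_le.1 (by linarith [hb i hi, abs_nonneg (u i)])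
  -- At the level −c, below all entries, the positive parts are linear, which gives equal plain
  -- sums. The squares come from integrating over [−c, c].
  have hsum : ∑ i ∈ s, (u i + c) = ∑ i ∈ s, (v i + c) := by
    have := h (-c)
    rwa [Finset.sum_congr rfl fun i hi ↦ max_eq_left (by linarith [(hu i hi).1]),
      Finset.sum_congr rfl fun i hi ↦ max_eq_left (by linarith [(hv i hi).1]),
      Finset.sum_congr rfl fun i _ ↦ sub_neg_eq_add (u i) c,
      Finset.sum_congr rfl fun i _ ↦ sub_neg_eq_add (v i) c] at this
  have hsq : ∑ i ∈ s, (u i + c) ^ 2 / 2 = ∑ i ∈ s, (v i + c) ^ 2 / 2 := by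
    rw [← Finset.sum_congr rfl fun i hi ↦ integral_max_sub_zero (hu i hi).1 (hu i hi).2,
      ← Finset.sum_congr rfl fun i hi ↦ integral_max_sub_zero (hv i hi).1 (hv i hi).2,
      ← intervalIntegral.integral_finsetSum, ← intervalIntegral.integral_finsetSum]
    · simp_rw [h]
    · exact fun i _ ↦ Continuous.intervalIntegrable (by fun_prop) _ _
    · exact fun i _ ↦ Continuous.intervalIntegrable (by fun_prop) _ _
  have e : ∀ a : ℝ, a ^ 2 = 2 * ((a + c) ^ 2 / 2) - 2 * c * (a + c) + c ^ 2 := fun a ↦ by ring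
  rw [Finset.sum_congr rfl fun i _ ↦ e (u i), Finset.sum_congr rfl fun i _ ↦ e (v i)]
  simp only [Finset.sum_add_distrib, Finset.sum_sub_distrib, ← Finset.mul_sum, hsq, hsum]

/-- The squared norm of `gren`, averaged over the permutations of a vector. -/
theorem sum_perm_gren_sq (n : ℕ) (x : ℕ → ℝ) :
    ∑ σ : PermBelow n, ∑ j ∈ Finset.range n, gren n (fun i ↦ x (σ.1 i)) j ^ 2 =
      ∑ σ : PermBelow n, ∑ j ∈ Finset.range n,
        ((∑ i ∈ Finset.range (j + 1), x (σ.1 i)) / ((j : ℝ) + 1)) ^ 2 := by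
  rw [← Finset.sum_product', ← Finset.sum_product']
  refine sum_sq_eq_of_sum_max_eq _
    (fun q : PermBelow n × ℕ ↦ gren n (fun i ↦ x (q.1.1 i)) q.2)
    (fun q ↦ (∑ i ∈ Finset.range (q.2 + 1), x (q.1.1 i)) / ((q.2 : ℝ) + 1)) fun t ↦ ?_
  rw [Finset.sum_product, Finset.sum_product]
  simp_rw [sum_max_gren_sub]
  rw [sum_perm_maxSum (fun i ↦ x i - t) le_rfl]
  refine Finset.sum_congr rfl fun σ _ ↦ Finset.sum_congr rfl fun j _ ↦ ?_
  rw [Finset.sum_sub_distrib]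
  simp only [Finset.sum_const, Finset.card_range, nsmul_eq_mul]
  have hj : (0 : ℝ) < j + 1 := by positivity
  -- The positive factor 1/(j + 1) passes into the positive part and turns the partial sum of x − t
  -- into the running mean minus t.
  rw [← max_div_div_right hj.le]
  congr 1
  · push_cast; field_simp
  · simp

end PosPart

/-! ### Second moments for exchangeable vectors -/

section Exchangeable

variable {Ω : Type*} [MeasurableSpace Ω] {P : Measure Ω}

/-- The first `n` coordinates of a process have an exchangeable law. -/
def IsExchangeableBelow (X : ℕ → Ω → ℝ) (n : ℕ) (P : Measure Ω) : Prop :=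
  ∀ σ : PermBelow n,
    IdentDistrib (fun ω (i : Fin n) ↦ X (σ.1 i) ω) (fun ω (i : Fin n) ↦ X i ω) P P

/-- Extension of a finite vector by zero. -/
def extendZero {n : ℕ} (v : Fin n → ℝ) (i : ℕ) : ℝ := if h : i < n then v ⟨i, h⟩ else 0

theorem continuous_extendZero {n : ℕ} : Continuous (extendZero : (Fin n → ℝ) → ℕ → ℝ) := by
  refine continuous_pi fun i ↦ ?_
  unfold extendZero
  split_ifs <;> fun_prop

theorem extendZero_restrict {n : ℕ} (x : ℕ → ℝ) {i : ℕ} (hi : i < n) :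
    extendZero (fun i : Fin n ↦ x i) i = x i := by
  simp [extendZero, hi]

theorem aestronglyMeasurable_gren_sq {X : ℕ → Ω → ℝ} {n : ℕ} (hX : ∀ i < n, AEMeasurable (X i) P)
    {j : ℕ} (hj : j < n) : AEStronglyMeasurable (fun ω ↦ gren n (fun i ↦ X i ω) j ^ 2) P := by
  have h : (fun ω ↦ gren n (fun i ↦ X i ω) j ^ 2) =
      (fun v : Fin n → ℝ ↦ gren n (extendZero v) j ^ 2) ∘ fun ω (i : Fin n) ↦ X i ω := by
    ext ω
    simp only [Function.comp]
    rw [gren_congr fun i hi ↦ extendZero_restrict (fun i ↦ X i ω) hi]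
  rw [h]
  refine ((((continuous_gren n hj).comp continuous_extendZero).pow 2).measurable.comp_aemeasurable
    (aemeasurable_pi_lambda _ fun i ↦ hX i i.2)).aestronglyMeasurable

/-- The second moment of `gren` of an exchangeable vector. -/
theorem IsExchangeableBelow.integral_gren_sq {X : ℕ → Ω → ℝ} {n : ℕ}
    (hexch : IsExchangeableBelow X n P) (hX : ∀ i < n, MemLp (X i) 2 P) :
    (∀ j < n, Integrable (fun ω ↦ gren n (fun i ↦ X i ω) j ^ 2) P) ∧
      ∑ j ∈ Finset.range n, ∫ ω, gren n (fun i ↦ X i ω) j ^ 2 ∂P =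
        ∑ j ∈ Finset.range n,
          ∫ ω, ((∑ i ∈ Finset.range (j + 1), X i ω) / ((j : ℝ) + 1)) ^ 2 ∂P := by
  have hperm : ∀ σ : PermBelow n, ∀ i < n, MemLp (X (σ.1 i)) 2 P :=
    fun σ i hi ↦ hX _ (σ.apply_lt hi)
  have hS : ∀ σ : PermBelow n, ∀ j ∈ Finset.range n, Integrable
      (fun ω ↦ ((∑ i ∈ Finset.range (j + 1), X (σ.1 i) ω) / ((j : ℝ) + 1)) ^ 2) P := by
    intro σ j hj
    have h := memLp_finsetSum (μ := P) (p := 2) (Finset.range (j + 1))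
      (f := fun i ↦ X (σ.1 i)) fun i hi ↦ hperm σ i (by
        have := Finset.mem_range.1 hi; have := Finset.mem_range.1 hj; omega)
    have := (h.mul_const (((j : ℝ) + 1)⁻¹)).integrable_sq
    simpa only [div_eq_mul_inv] using this
  have hG : ∀ σ : PermBelow n, ∀ j < n,
      Integrable (fun ω ↦ gren n (fun i ↦ X (σ.1 i) ω) j ^ 2) P := by
    intro σ j hj
    -- One squared entry is at most the sum over all permutations and entries, which equals an
    -- integrable sum of squared running means.
    refine (integrable_finsetSum (Finset.univ : Finset (PermBelow n)) fun σ' _ ↦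
      integrable_finsetSum (Finset.range n) (hS σ')).mono'
      (aestronglyMeasurable_gren_sq (X := fun i ↦ X (σ.1 i))
        (fun i hi ↦ (hperm σ i hi).aemeasurable) hj) (ae_of_all _ fun ω ↦ ?_)
    rw [Real.norm_of_nonneg (sq_nonneg _), ← sum_perm_gren_sq n fun i ↦ X i ω]
    calc gren n (fun i ↦ X (σ.1 i) ω) j ^ 2
        ≤ ∑ j ∈ Finset.range n, gren n (fun i ↦ X (σ.1 i) ω) j ^ 2 :=
          Finset.single_le_sum (f := fun j ↦ gren n (fun i ↦ X (σ.1 i) ω) j ^ 2)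
            (fun _ _ ↦ sq_nonneg _) (Finset.mem_range.2 hj)
      _ ≤ _ := Finset.single_le_sum
            (f := fun σ : PermBelow n ↦
              ∑ j ∈ Finset.range n, gren n (fun i ↦ X (σ.1 i) ω) j ^ 2)
            (fun _ _ ↦ Finset.sum_nonneg fun _ _ ↦ sq_nonneg _) (Finset.mem_univ σ)
  -- Exchangeability removes σ from the expectation of any function of the first n coordinates.
  have hlaw : ∀ (F : (ℕ → ℝ) → ℝ), (Measurable fun v : Fin n → ℝ ↦ F (extendZero v)) →
      (∀ x x' : ℕ → ℝ, (∀ i < n, x i = x' i) → F x = F x') → ∀ σ : PermBelow n,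
      ∫ ω, F (fun i ↦ X (σ.1 i) ω) ∂P = ∫ ω, F (fun i ↦ X i ω) ∂P := by
    intro F hF hF' σ
    have h := ((hexch σ).comp hF).integral_eq
    simp only [Function.comp_def] at h
    convert h using 2
    · ext ω
      exact hF' _ _ fun i hi ↦ (extendZero_restrict (fun i ↦ X (σ.1 i) ω) hi).symm
    · ext ω
      exact hF' _ _ fun i hi ↦ (extendZero_restrict (fun i ↦ X i ω) hi).symm
  have h1 : PermBelow n := ⟨1, fun _ _ ↦ rfl⟩
  refine ⟨fun j hj ↦ hG ⟨1, fun _ _ ↦ rfl⟩ j hj, ?_⟩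
  have key : ∑ σ : PermBelow n, ∑ j ∈ Finset.range n,
        ∫ ω, gren n (fun i ↦ X (σ.1 i) ω) j ^ 2 ∂P =
      ∑ σ : PermBelow n, ∑ j ∈ Finset.range n,
        ∫ ω, ((∑ i ∈ Finset.range (j + 1), X (σ.1 i) ω) / ((j : ℝ) + 1)) ^ 2 ∂P := by
    have e1 : ∀ σ : PermBelow n, ∑ j ∈ Finset.range n,
        ∫ ω, gren n (fun i ↦ X (σ.1 i) ω) j ^ 2 ∂P =
        ∫ ω, ∑ j ∈ Finset.range n, gren n (fun i ↦ X (σ.1 i) ω) j ^ 2 ∂P := fun σ ↦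
      (integral_finsetSum _ fun j hj ↦ hG σ j (Finset.mem_range.1 hj)).symm
    have e2 := fun σ : PermBelow n ↦ (integral_finsetSum _ (hS σ)).symm
    rw [Finset.sum_congr rfl fun σ _ ↦ e1 σ, Finset.sum_congr rfl fun σ _ ↦ e2 σ,
      ← integral_finsetSum, ← integral_finsetSum]
    · exact integral_congr_ae (ae_of_all _ fun ω ↦ sum_perm_gren_sq n fun i ↦ X i ω)
    · exact fun σ _ ↦ integrable_finsetSum _ (hS σ)
    · exact fun σ _ ↦ integrable_finsetSum _ fun j hj ↦ hG σ j (Finset.mem_range.1 hj)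
  have l1 : ∀ σ : PermBelow n, ∑ j ∈ Finset.range n,
        ∫ ω, gren n (fun i ↦ X (σ.1 i) ω) j ^ 2 ∂P =
        ∑ j ∈ Finset.range n, ∫ ω, gren n (fun i ↦ X i ω) j ^ 2 ∂P := fun σ ↦
    Finset.sum_congr rfl fun j hj ↦ hlaw (fun x ↦ gren n x j ^ 2)
      (((continuous_gren n (Finset.mem_range.1 hj)).comp continuous_extendZero).pow 2).measurable
      (fun x x' h ↦ by rw [gren_congr h]) σ
  have l2 : ∀ σ : PermBelow n, ∑ j ∈ Finset.range n,
        ∫ ω, ((∑ i ∈ Finset.range (j + 1), X (σ.1 i) ω) / ((j : ℝ) + 1)) ^ 2 ∂P =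
        ∑ j ∈ Finset.range n,
          ∫ ω, ((∑ i ∈ Finset.range (j + 1), X i ω) / ((j : ℝ) + 1)) ^ 2 ∂P := fun σ ↦
    Finset.sum_congr rfl fun j hj ↦ hlaw
      (fun x ↦ ((∑ i ∈ Finset.range (j + 1), x i) / ((j : ℝ) + 1)) ^ 2)
      (by
        have : Continuous fun x : ℕ → ℝ ↦
          ((∑ i ∈ Finset.range (j + 1), x i) / ((j : ℝ) + 1)) ^ 2 := by fun_prop
        exact (this.comp continuous_extendZero).measurable)
      (fun x x' h ↦ by
        have := Finset.mem_range.1 hj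
        rw [Finset.sum_congr rfl fun i hi ↦ h i (by have := Finset.mem_range.1 hi; omega)]) σ
  rw [Finset.sum_congr rfl fun σ _ ↦ l1 σ, Finset.sum_congr rfl fun σ _ ↦ l2 σ,
    Finset.sum_const, Finset.sum_const] at key
  have hc : (Finset.univ : Finset (PermBelow n)).card ≠ 0 :=
    Finset.card_ne_zero.2 ⟨h1, Finset.mem_univ _⟩
  -- Every permutation contributes the same amount, so their number cancels.
  exact smul_right_injective ℝ hc key

/-- The second moment of `gren` of an exchangeable vector, in terms of the variances of its partial
sums. -/
theorem IsExchangeableBelow.sum_integral_gren_sq {X : ℕ → Ω → ℝ} {n : ℕ}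
    (hexch : IsExchangeableBelow X n P) (hX : ∀ i < n, MemLp (X i) 2 P) {θ c : ℝ}
    (hvar : ∀ m ≤ n, ∫ ω, (∑ i ∈ Finset.range m, X i ω) ^ 2 ∂P =
      c * (m * θ - (m * θ) ^ 2)) :
    ∑ j ∈ Finset.range n, ∫ ω, gren n (fun i ↦ X i ω) j ^ 2 ∂P =
      c * ∑ j ∈ Finset.Icc 1 n, θ * (1 / (j : ℝ) - θ) := by
  rw [(hexch.integral_gren_sq hX).2, Finset.mul_sum, Finset.range_eq_Ico,
    Finset.sum_Ico_eq_sum_range, ← Finset.Ico_add_one_right_eq_Icc, Finset.sum_Ico_eq_sum_range]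
  refine Finset.sum_congr rfl fun j hj ↦ ?_
  have hj : j < n := by simpa using hj
  have h := hvar (j + 1) hj
  simp only [zero_add, div_pow]
  rw [integral_div, h]
  have : (j : ℝ) + 1 ≠ 0 := by positivity
  push_cast
  rw [add_comm (1 : ℝ)]
  field_simp

end Exchangeable

/-! ### The limit process on a period of constancy -/

section Gaussian

variable {Ω : Type*} [MeasurableSpace Ω] {P : Measure Ω}

/-- Gaussian vectors with equal means and covariances are identically distributed. -/
theorem identDistrib_of_hasGaussianLaw {n : ℕ} {X X' : Fin n → Ω → ℝ} [IsProbabilityMeasure P]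
    (hX : HasGaussianLaw (fun ω i ↦ X i ω) P) (hX' : HasGaussianLaw (fun ω i ↦ X' i ω) P)
    (hmean : ∀ i, ∫ ω, X i ω ∂P = ∫ ω, X' i ω ∂P)
    (hcov : ∀ i j, cov[X i, X j; P] = cov[X' i, X' j; P]) :
    IdentDistrib (fun ω i ↦ X i ω) (fun ω i ↦ X' i ω) P P where
  aemeasurable_fst := hX.aemeasurable
  aemeasurable_snd := hX'.aemeasurable
  map_eq := by
    have := hX.isGaussian_map
    have := hX'.isGaussian_map
    -- The characteristic function of a Gaussian vector at L depends only on the mean and variance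
    -- of L, which are expanded in coordinates.
    refine Measure.ext_of_charFunDual ?_
    ext L
    have hL : ∀ v : Fin n → ℝ, L v = ∑ i, L (Pi.single i 1) * v i := by
      intro v
      conv_lhs => rw [← Finset.univ_sum_single v, map_sum]
      refine Finset.sum_congr rfl fun i _ ↦ ?_
      rw [mul_comm, ← smul_eq_mul, ← map_smul, ← Pi.single_smul, smul_eq_mul, mul_one]
    have h2 : ∀ {Z : Fin n → Ω → ℝ}, HasGaussianLaw (fun ω i ↦ Z i ω) P → ∀ i, MemLp (Z i) 2 P :=
      fun hZ i ↦ (hZ.map_fun (ContinuousLinearMap.proj i)).memLp_two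
    have hm : ∀ {Z : Fin n → Ω → ℝ}, HasGaussianLaw (fun ω i ↦ Z i ω) P →
        ∫ ω, L (fun i ↦ Z i ω) ∂P = ∑ i, L (Pi.single i 1) * ∫ ω, Z i ω ∂P := by
      intro Z hZ
      simp_rw [hL (fun i ↦ Z i _)]
      rw [integral_finsetSum _ fun i _ ↦ ((h2 hZ i).integrable (by norm_num)).const_mul _]
      simp_rw [integral_const_mul]
    have hv : ∀ {Z : Fin n → Ω → ℝ}, HasGaussianLaw (fun ω i ↦ Z i ω) P →
        Var[fun ω ↦ L (fun i ↦ Z i ω); P] =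
          ∑ i, ∑ j, L (Pi.single i 1) * (L (Pi.single j 1) * cov[Z i, Z j; P]) := by
      intro Z hZ
      simp_rw [hL (fun i ↦ Z i _)]
      rw [variance_fun_sum' fun i _ ↦ (h2 hZ i).const_mul _]
      simp_rw [covariance_const_mul_left, covariance_const_mul_right]
    rw [hX.charFunDual_map_eq_fun, hX'.charFunDual_map_eq_fun, hm hX, hm hX', hv hX, hv hX']
    simp_rw [hmean, hcov]

variable {p : ℕ → ℝ} {Y : ℕ → Ω → ℝ}

theorem IsLimitProcess.memLp (hY : IsLimitProcess p Y P) (x : ℕ) : MemLp (Y x) 2 P :=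
  (hY.gaussian.hasGaussianLaw_eval x).memLp_two

theorem IsLimitProcess.hasGaussianLaw_comp (hY : IsLimitProcess p Y P) {n : ℕ} (f : Fin n → ℕ) :
    HasGaussianLaw (fun ω i ↦ Y (f i) ω) P := by
  have := (hY.gaussian.comp_right f).hasGaussianLaw Finset.univ
  exact this.map_fun (ContinuousLinearMap.pi fun i : Fin n ↦
    ContinuousLinearMap.proj (⟨i, Finset.mem_univ i⟩ : (Finset.univ : Finset (Fin n))))

/-- On a period the covariance is θδ − θ², invariant under permutation, and a Gaussian law is
determined by its mean and covariance. -/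
theorem IsLimitProcess.isExchangeableBelow [IsProbabilityMeasure P]
    (hY : IsLimitProcess p Y P) {r n : ℕ} {θ : ℝ}
    (h : ∀ i < n, p (r + i) = θ) : IsExchangeableBelow (fun i ↦ Y (r + i)) n P := by
  intro σ
  refine identDistrib_of_hasGaussianLaw (X := fun i : Fin n ↦ Y (r + σ.1 i))
    (X' := fun i : Fin n ↦ Y (r + i)) (hY.hasGaussianLaw_comp _) (hY.hasGaussianLaw_comp _)
    (fun i ↦ by rw [hY.mean, hY.mean]) fun i j ↦ ?_
  rw [hY.cov, hY.cov, h _ i.2, h _ j.2, h _ (σ.apply_lt i.2), h _ (σ.apply_lt j.2)]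
  simp

/-- Each of the m rows of the covariance matrix sums to θ − mθ². The factor 1 is the constant `c` of
`sum_integral_gren_sq`, which becomes 1/n for a sample. -/
theorem IsLimitProcess.integral_sum_sq [IsProbabilityMeasure P]
    (hY : IsLimitProcess p Y P) {r n : ℕ} {θ : ℝ}
    (h : ∀ i < n, p (r + i) = θ) {m : ℕ} (hm : m ≤ n) :
    ∫ ω, (∑ i ∈ Finset.range m, Y (r + i) ω) ^ 2 ∂P = 1 * (m * θ - (m * θ) ^ 2) := by
  have hmean : ∫ ω, ∑ i ∈ Finset.range m, Y (r + i) ω ∂P = 0 := by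
    rw [integral_finsetSum _ fun i _ ↦ (hY.memLp _).integrable (by norm_num)]
    simp [hY.mean]
  rw [← variance_of_integral_eq_zero
    (memLp_finsetSum (μ := P) (p := 2) _ fun i _ ↦ hY.memLp _).aemeasurable hmean,
    variance_fun_sum' fun i _ ↦ hY.memLp _]
  have : ∀ i ∈ Finset.range m, ∑ j ∈ Finset.range m, cov[Y (r + i), Y (r + j); P] =
      θ - m * θ ^ 2 := by
    intro i hi
    have hi' := Finset.mem_range.1 hi
    calc ∑ j ∈ Finset.range m, cov[Y (r + i), Y (r + j); P]
        = ∑ j ∈ Finset.range m, ((if i = j then θ else 0) - θ ^ 2) := by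
          refine Finset.sum_congr rfl fun j hj ↦ ?_
          have hj' := Finset.mem_range.1 hj
          rw [hY.cov, h i (by omega), h j (by omega)]
          simp [sq]
      _ = _ := by simp [Finset.sum_sub_distrib, hi']
  rw [Finset.sum_congr rfl this]
  simp
  ring

end Gaussian

/-! ### Periods of constancy as intervals -/

section Periods

variable {p : ℕ → ℝ}

theorem IsDecreasingPMF.constancyPeriod_finite (hp : IsDecreasingPMF p) {x : ℕ} (hx : 0 < p x) :
    (constancyPeriod p x).Finite := by
  have h := hp.hasSum_one.summable.tendsto_cofinite_zero.eventually (gt_mem_nhds hx)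
  exact h.subset fun z hz ↦ by simp [show p z = p x from hz]

theorem IsDecreasingPMF.constancyPeriod_infinite (hp : IsDecreasingPMF p) {x : ℕ} (hx : p x = 0) :
    (constancyPeriod p x).Infinite := by
  refine (Set.infinite_of_not_bddAbove ?_).mono (s := Set.Ici x) fun z hz ↦ ?_
  · exact not_bddAbove_Ici x
  · exact le_antisymm (hp.antitone hz) (hx.trans_le (hp.nonneg z))

theorem IsDecreasingPMF.constancyPeriod_eq_Ico (hp : IsDecreasingPMF p) {x : ℕ} (hx : 0 < p x) :
    ∃ r n : ℕ, 0 < n ∧ constancyPeriod p x = Set.Ico r (r + n) := by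
  set C := constancyPeriod p x
  have hne : C.Nonempty := ⟨x, rfl⟩
  have hfin : C.Finite := hp.constancyPeriod_finite hx
  have h1 : sInf C ∈ C := Nat.sInf_mem hne
  have h2 : sSup C ∈ C := Nat.sSup_mem hne hfin.bddAbove
  have h12 : sInf C ≤ sSup C := Nat.sInf_le h2
  refine ⟨sInf C, sSup C + 1 - sInf C, by omega, ?_⟩
  ext z
  rw [Set.mem_Ico]
  constructor
  · intro hz
    have := Nat.sInf_le hz
    have := le_csSup hfin.bddAbove hz
    omega
  · rintro ⟨ha, hb⟩
    have e1 : p (sInf C) = p x := h1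
    have e2 : p (sSup C) = p x := h2
    have i1 := hp.antitone ha
    have i2 := hp.antitone (show z ≤ sSup C by omega)
    exact le_antisymm (by linarith) (by linarith)

theorem grenTransform_of_eq_Ico {x r n : ℕ} (hn : 0 < n)
    (h : constancyPeriod p x = Set.Ico r (r + n)) {j : ℕ} (hj : j < n) (y : ℕ → ℝ) :
    grenTransform p y (r + j) = gren n (fun i ↦ y (r + i)) j := by
  have h' : constancyPeriod p (r + j) = Set.Ico r (r + n) := by
    have : r + j ∈ constancyPeriod p x := by rw [h]; exact ⟨by omega, by omega⟩
    rw [← h]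
    ext z
    simp only [constancyPeriod, Set.mem_ofPred_eq, show p (r + j) = p x from this]
  have hI : sInf (Set.Ico r (r + n)) = r := csInf_Ico (by omega)
  have hS : sSup (Set.Ico r (r + n)) = r + n - 1 :=
    IsGreatest.csSup_eq ⟨⟨by omega, by omega⟩, fun z hz ↦ by have := hz.2; omega⟩
  unfold grenTransform
  rw [h', if_pos (Set.finite_Ico _ _), hI, hS, show r + n - 1 + 1 - r = n by omega,
    Nat.add_sub_cancel_left]

theorem IsDecreasingPMF.grenTransform_of_eq_zero (hp : IsDecreasingPMF p) {x : ℕ} (hx : p x = 0)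
    (y : ℕ → ℝ) : grenTransform p y x = y x :=
  if_neg (hp.constancyPeriod_infinite hx)

variable {Ω : Type*} [MeasurableSpace Ω] {P : Measure Ω} {Y : ℕ → Ω → ℝ}

theorem IsLimitProcess.ae_eq_zero (hY : IsLimitProcess p Y P) {x : ℕ} (hx : p x = 0) :
    ∀ᵐ ω ∂P, Y x ω = 0 := by
  have h := hY.cov x x
  rw [covariance_self (hY.memLp x).aemeasurable, if_pos rfl, hx,
    variance_of_integral_eq_zero (hY.memLp x).aemeasurable (hY.mean x),
    mul_zero, sub_zero, integral_eq_zero_iff_of_nonneg (fun _ ↦ sq_nonneg _)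
      (hY.memLp x).integrable_sq] at h
  filter_upwards [h] with ω hω
  simpa using hω

theorem integrable_grenTransform_sq [IsProbabilityMeasure P]
    (hp : IsDecreasingPMF p) (hY : IsLimitProcess p Y P) (x : ℕ) :
    Integrable (fun ω ↦ grenTransform p (Y · ω) x ^ 2) P := by
  rcases (hp.nonneg x).eq_or_lt with hx | hx
  · simp_rw [hp.grenTransform_of_eq_zero hx.symm]
    exact (hY.memLp x).integrable_sq
  · obtain ⟨r, n, hn, h⟩ := hp.constancyPeriod_eq_Ico hx
    have hxm : x ∈ Set.Ico r (r + n) := h ▸ (rfl : p x = p x)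
    obtain ⟨j, rfl⟩ := Nat.exists_eq_add_of_le hxm.1
    have hj : j < n := by have := hxm.2; omega
    simp_rw [grenTransform_of_eq_Ico hn h hj]
    have hθ : ∀ i < n, p (r + i) = p (r + j) := fun i hi ↦ by
      have : r + i ∈ constancyPeriod p (r + j) := by rw [h]; exact ⟨by omega, by omega⟩
      exact this
    exact ((hY.isExchangeableBelow hθ).integral_gren_sq fun i _ ↦ hY.memLp _).1 j hj

theorem integral_grenTransform_sq_of_eq_zero (hp : IsDecreasingPMF p) (hY : IsLimitProcess p Y P)
    {x : ℕ} (hx : p x = 0) : ∫ ω, grenTransform p (Y · ω) x ^ 2 ∂P = 0 := by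
  simp_rw [hp.grenTransform_of_eq_zero hx]
  refine integral_eq_zero_of_ae ?_
  filter_upwards [hY.ae_eq_zero hx] with ω hω
  simp [hω]

/-- The contribution of one period of constancy to the expected squared norm. -/
theorem hasSum_integral_grenTransform_sq_constancyPeriod [IsProbabilityMeasure P]
    (hp : IsDecreasingPMF p)
    (hY : IsLimitProcess p Y P) (x : ℕ) :
    HasSum (fun z : constancyPeriod p x ↦ ∫ ω, grenTransform p (Y · ω) z ^ 2 ∂P)
      (∑ j ∈ Finset.Icc 1 (constancyPeriod p x).ncard, p x * (1 / (j : ℝ) - p x)) := by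
  rcases (hp.nonneg x).eq_or_lt with hx | hx
  -- On the zero set every term vanishes, whatever the value of `ncard`.
  · simp only [← hx, zero_mul, Finset.sum_const_zero]
    convert hasSum_zero with z
    exact integral_grenTransform_sq_of_eq_zero hp hY ((show p z = p x from z.2).trans hx.symm)
  · obtain ⟨r, n, hn, h⟩ := hp.constancyPeriod_eq_Ico hx
    have hθ : ∀ i < n, p (r + i) = p x := fun i hi ↦ by
      have : r + i ∈ constancyPeriod p x := by rw [h]; exact ⟨by omega, by omega⟩
      exact this
    have hsum := (hY.isExchangeableBelow hθ).sum_integral_gren_sq (fun i _ ↦ hY.memLp _)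
      fun m hm ↦ hY.integral_sum_sq hθ hm
    have h' : constancyPeriod p x = (Finset.Ico r (r + n) : Finset ℕ) := by
      rw [h, Finset.coe_Ico]
    have hcard : (constancyPeriod p x).ncard = n := by
      rw [h', Set.ncard_coe_finset, Nat.card_Ico, Nat.add_sub_cancel_left]
    rw [hcard, ← one_mul (∑ j ∈ Finset.Icc 1 n, _), ← hsum]
    have e : ∑ j ∈ Finset.range n, ∫ ω, gren n (fun i ↦ Y (r + i) ω) j ^ 2 ∂P =
        ∑ z ∈ Finset.Ico r (r + n), ∫ ω, grenTransform p (Y · ω) z ^ 2 ∂P := by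
      rw [Finset.sum_Ico_eq_sum_range, Nat.add_sub_cancel_left]
      refine Finset.sum_congr rfl fun j hj ↦ ?_
      simp_rw [grenTransform_of_eq_Ico hn h (Finset.mem_range.1 hj)]
    rw [e, h']
    exact Finset.hasSum (Finset.Ico r (r + n)) fun z ↦ ∫ ω, grenTransform p (Y · ω) z ^ 2 ∂P

end Periods

/-! ### Summation over the periods -/

section Decomposition

variable {p : ℕ → ℝ} {I : Set ℕ} {C : ℕ → Set ℕ} {θ : ℕ → ℝ}

theorem IsConstancyDecomposition.lt (hC : IsConstancyDecomposition p I C θ) {i j : ℕ} (hij : i < j)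
    (hj : j ∈ I) : θ j < θ i := by
  induction j, hij using Nat.le_induction with
  | base => exact hC.strictAnti i hj
  | succ k hk ih => exact (hC.strictAnti k hj).trans (ih (hC.isLowerSet k.le_succ hj))

theorem IsConstancyDecomposition.existsUnique_mem (hC : IsConstancyDecomposition p I C θ) (x : ℕ) :
    ∃! i : I, x ∈ C i := by
  have hx : x ∈ ⋃ i ∈ I, C i := by rw [hC.cover]; trivial
  simp only [Set.mem_iUnion] at hx
  obtain ⟨i, hi, hxi⟩ := hx
  refine ⟨⟨i, hi⟩, hxi, fun j hj ↦ Subtype.ext ?_⟩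
  by_contra hne
  exact Set.disjoint_left.1 (hC.disjoint j.2 hi hne) hj hxi

/-- Distinct blocks carry distinct values because θ strictly decreases, so a block is a full level
set of `p`. -/
theorem IsConstancyDecomposition.eq_constancyPeriod (hC : IsConstancyDecomposition p I C θ)
    {i x : ℕ} (hi : i ∈ I) (hx : x ∈ C i) : C i = constancyPeriod p x := by
  ext z
  refine ⟨fun hz ↦ (hC.value i hi z hz).trans (hC.value i hi x hx).symm, fun hz ↦ ?_⟩
  obtain ⟨⟨j, hj⟩, hzj, -⟩ := hC.existsUnique_mem z
  have hzj : z ∈ C j := hzj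
  have h : θ j = θ i := by
    rw [← hC.value j hj z hzj, ← hC.value i hi x hx]; exact hz
  rcases lt_trichotomy i j with h' | rfl | h'
  · exact absurd h (hC.lt h' hj).ne
  · exact hzj
  · exact absurd h (hC.lt h' hi).ne'

theorem IsConstancyDecomposition.nonneg (hC : IsConstancyDecomposition p I C θ)
    (hp : IsDecreasingPMF p) {i : ℕ} (hi : i ∈ I) : 0 ≤ θ i := by
  obtain ⟨x, hx⟩ := hC.nonempty i hi
  exact hC.value i hi x hx ▸ hp.nonneg x

theorem IsConstancyDecomposition.hasSum_of_hasSum (hC : IsConstancyDecomposition p I C θ)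
    {e : ℕ → ℝ} {b : I → ℝ} {T : ℝ} (he : HasSum e T)
    (hb : ∀ i : I, HasSum (fun z : C i ↦ e z) (b i)) : HasSum b T := by
  have h := (Set.sigmaEquiv (fun i : I ↦ C i) hC.existsUnique_mem).hasSum_iff.2 he
  exact h.sigma hb

variable {Ω : Type*} [MeasurableSpace Ω] {P : Measure Ω} {Y : ℕ → Ω → ℝ}

theorem hasSum_integral_grenTransform_sq_block [IsProbabilityMeasure P] (hp : IsDecreasingPMF p)
    (hY : IsLimitProcess p Y P) (hC : IsConstancyDecomposition p I C θ) (i : I) :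
    HasSum (fun z : C i ↦ ∫ ω, grenTransform p (Y · ω) z ^ 2 ∂P)
      (∑ j ∈ Finset.Icc 1 (C i).ncard, θ i * (1 / (j : ℝ) - θ i)) := by
  obtain ⟨x, hx⟩ := hC.nonempty i i.2
  have h := hasSum_integral_grenTransform_sq_constancyPeriod hp hY x
  rwa [← hC.eq_constancyPeriod i.2 hx, hC.value i i.2 x hx] at h

/-- Since 1/j − θ ≤ 1, a block contributes at most |C i| θ i, its share of ∑ p. -/
theorem summable_integral_grenTransform_sq [IsProbabilityMeasure P] (hp : IsDecreasingPMF p)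
    (hY : IsLimitProcess p Y P) (hC : IsConstancyDecomposition p I C θ) :
    Summable fun x ↦ ∫ ω, grenTransform p (Y · ω) x ^ 2 ∂P := by
  have hpS := (summable_partition hp.nonneg hC.existsUnique_mem).1 hp.hasSum_one.summable
  refine (summable_partition (fun x ↦ integral_nonneg fun _ ↦ sq_nonneg _)
    hC.existsUnique_mem).2 ⟨fun i ↦
      (hasSum_integral_grenTransform_sq_block hp hY hC i).summable, ?_⟩
  refine Summable.of_nonneg_of_le (fun i ↦ tsum_nonneg fun _ ↦ integral_nonneg fun _ ↦ sq_nonneg _)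
    (fun i ↦ ?_) hpS.2
  rw [(hasSum_integral_grenTransform_sq_block hp hY hC i).tsum_eq]
  have hθ := hC.nonneg hp i.2
  calc ∑ j ∈ Finset.Icc 1 (C i).ncard, θ i * (1 / (j : ℝ) - θ i)
      ≤ ∑ j ∈ Finset.Icc 1 (C i).ncard, θ i := by
        refine Finset.sum_le_sum fun j hj ↦ mul_le_of_le_one_right hθ ?_
        have : (1 : ℝ) ≤ j := by exact_mod_cast (Finset.mem_Icc.1 hj).1
        have := (div_le_one (by linarith)).2 this
        linarith
    _ = (C i).ncard * θ i := by simp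
    -- For an infinite block both sides are 0 by the conventions for `ncard` and `tsum`.
    _ = ∑' z : C i, θ i := by rw [tsum_const]; simp [Set.ncard]
    _ = ∑' z : C i, p z := tsum_congr fun z ↦ (hC.value i i.2 z z.2).symm

/-- Tonelli: a nonnegative series with finite total expectation converges almost surely and has an
integrable sum. -/
theorem ae_summable_of_summable_integral {f : ℕ → Ω → ℝ} (hf : ∀ x, Integrable (f x) P)
    (h0 : ∀ x ω, 0 ≤ f x ω) (hs : Summable fun x ↦ ∫ ω, f x ω ∂P) :
    (∀ᵐ ω ∂P, Summable fun x ↦ f x ω) ∧ Integrable (fun ω ↦ ∑' x, f x ω) P ∧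
      HasSum (fun x ↦ ∫ ω, f x ω ∂P) (∫ ω, ∑' x, f x ω ∂P) := by
  have hl : ∀ x, ∫⁻ ω, ‖f x ω‖ₑ ∂P = ENNReal.ofReal (∫ ω, f x ω ∂P) := fun x ↦ by
    rw [ofReal_integral_eq_lintegral_ofReal (hf x) (ae_of_all _ (h0 x))]
    simp_rw [Real.enorm_of_nonneg (h0 x _)]
  have hfin : ∑' x, ∫⁻ ω, ‖f x ω‖ₑ ∂P ≠ ⊤ := by
    simp_rw [hl]
    exact hs.tsum_ofReal_ne_top
  have hae : ∀ᵐ ω ∂P, Summable fun x ↦ f x ω := by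
    refine (summable_norm_of_tsum_eLpNorm_ne_top (p := 1) le_rfl (fun x ↦ (hf x).1) ?_).mono
      fun ω hω ↦ hω.of_norm
    simpa only [eLpNorm_one_eq_lintegral_enorm] using hfin
  refine ⟨hae, ⟨?_, ?_⟩, hasSum_integral_of_summable_integral_norm hf ?_⟩
  · refine aestronglyMeasurable_of_tendsto_ae atTop
      (f := fun n ω ↦ ∑ x ∈ Finset.range n, f x ω)
      (fun n ↦ (integrable_finsetSum _ fun x _ ↦ hf x).1) ?_
    filter_upwards [hae] with ω hω using hω.hasSum.tendsto_sum_nat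
  · refine lt_of_le_of_lt (lintegral_mono fun ω ↦ enorm_tsum_le_tsum_enorm) ?_
    rw [lintegral_tsum fun x ↦ (hf x).1.enorm]
    exact hfin.lt_top
  · simpa only [Real.norm_of_nonneg (h0 _ _)] using hs

theorem hasSum_integral_tsum_grenTransform_sq [IsProbabilityMeasure P] (hp : IsDecreasingPMF p)
    (hY : IsLimitProcess p Y P) (hC : IsConstancyDecomposition p I C θ) :
    (∀ᵐ ω ∂P, Summable fun x ↦ grenTransform p (Y · ω) x ^ 2) ∧
      Integrable (fun ω ↦ ∑' x, grenTransform p (Y · ω) x ^ 2) P ∧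
      HasSum (fun i : I ↦ ∑ j ∈ Finset.Icc 1 (C i).ncard, θ i * (1 / (j : ℝ) - θ i))
        (∫ ω, ∑' x, grenTransform p (Y · ω) x ^ 2 ∂P) := by
  obtain ⟨h1, h2, h3⟩ := ae_summable_of_summable_integral (integrable_grenTransform_sq hp hY)
    (fun _ _ ↦ sq_nonneg _) (summable_integral_grenTransform_sq hp hY hC)
  exact ⟨h1, h2, hC.hasSum_of_hasSum h3 (hasSum_integral_grenTransform_sq_block hp hY hC)⟩

theorem hasSum_integral_sum_grenTransform_sq_div [IsProbabilityMeasure P] (hp : IsDecreasingPMF p)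
    (hY : IsLimitProcess p Y P) (hC : IsConstancyDecomposition p I C θ) {κ : ℕ}
    (hκ : IsGreatest {x | 0 < p x} κ) :
    Integrable (fun ω ↦ ∑ x ∈ Finset.range (κ + 1), grenTransform p (Y · ω) x ^ 2 / p x) P ∧
      HasSum (fun i : {i // i ∈ I ∧ 0 < θ i} ↦
          ∑ j ∈ Finset.Icc 1 (C i).ncard, (1 / (j : ℝ) - θ i))
        (∫ ω, ∑ x ∈ Finset.range (κ + 1), grenTransform p (Y · ω) x ^ 2 / p x ∂P) := by
  have hint : ∀ x ∈ Finset.range (κ + 1),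
      Integrable (fun ω ↦ grenTransform p (Y · ω) x ^ 2 / p x) P :=
    fun x _ ↦ (integrable_grenTransform_sq hp hY x).div_const _
  refine ⟨integrable_finsetSum _ hint, ?_⟩
  rw [integral_finsetSum _ hint]
  have hsum : HasSum (fun x ↦ ∫ ω, grenTransform p (Y · ω) x ^ 2 / p x ∂P)
      (∑ x ∈ Finset.range (κ + 1), ∫ ω, grenTransform p (Y · ω) x ^ 2 / p x ∂P) := by
    -- Beyond κ the term is a division by zero, hence 0.
    refine hasSum_sum_of_ne_finset_zero fun x hx ↦ ?_
    have : ¬ 0 < p x := fun h ↦ hx (Finset.mem_range.2 (Nat.lt_succ_of_le (hκ.2 h)))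
    have : p x = 0 := le_antisymm (not_lt.1 this) (hp.nonneg x)
    simp [this]
  have hb : ∀ i : I, HasSum (fun z : C i ↦ ∫ ω, grenTransform p (Y · ω) z ^ 2 / p z ∂P)
      ((∑ j ∈ Finset.Icc 1 (C i).ncard, θ i * (1 / (j : ℝ) - θ i)) / θ i) := by
    intro i
    have e : (fun z : C i ↦ ∫ ω, grenTransform p (Y · ω) z ^ 2 / p z ∂P) =
        fun z : C i ↦ (∫ ω, grenTransform p (Y · ω) z ^ 2 ∂P) / θ i := by
      ext z
      rw [integral_div, hC.value i i.2 z z.2]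
    rw [e]
    exact (hasSum_integral_grenTransform_sq_block hp hY hC i).div_const (θ i)
  have h := hC.hasSum_of_hasSum hsum hb
  let f : {i // i ∈ I ∧ 0 < θ i} → I := fun i ↦ ⟨i, i.2.1⟩
  have hf : Function.Injective f := fun i j hij ↦ Subtype.ext (congrArg (fun k : I ↦ (k : ℕ)) hij)
  -- Only a block with θ = 0 is dropped, and its term is 0.
  rw [← hf.hasSum_iff] at h
  · have e : (fun i : {i // i ∈ I ∧ 0 < θ i} ↦
        ∑ j ∈ Finset.Icc 1 (C i).ncard, (1 / (j : ℝ) - θ i)) =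
        (fun i : I ↦ (∑ j ∈ Finset.Icc 1 (C i).ncard, θ i * (1 / (j : ℝ) - θ i)) / θ i) ∘ f := by
      ext i
      have : θ i ≠ 0 := i.2.2.ne'
      simp only [f, Function.comp, ← Finset.mul_sum]
      rw [mul_div_cancel_left₀ _ this]
    rw [e]
    exact h
  · intro i hi
    have : ¬ 0 < θ i := fun h0 ↦ hi ⟨⟨i, i.2, h0⟩, rfl⟩
    have : θ i = 0 := le_antisymm (not_lt.1 this) (hC.nonneg hp i.2)
    simp [this]

end Decomposition

/-! ### Independence of the majorant from trailing zeros -/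

section Restrict

variable {N K : ℕ} {w : ℕ → ℝ}

/-- The smallest slope is the last one, and it is nonnegative because the constant total sum
dominates all partial sums. -/
theorem gren_nonneg_of_nonneg (hw : ∀ i, 0 ≤ w i) {j : ℕ} (hj : j < N) : 0 ≤ gren N w j := by
  refine le_trans ?_ (gren_antitoneOn (i := j) (j := N - 1) (by omega) (by omega))
  obtain ⟨M, rfl⟩ : ∃ M, N = M + 1 := ⟨N - 1, by omega⟩
  rw [gren_eq, Nat.add_sub_cancel, leastConcaveMajorant_self, sub_nonneg]
  have := leastConcaveMajorant_le_affine (n := M + 1)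
    (S := fun m ↦ ∑ i ∈ Finset.range m, w i) (a := ∑ i ∈ Finset.range (M + 1), w i) (b := 0)
    (fun m hm ↦ by
      rw [zero_mul, add_zero]
      exact Finset.sum_le_sum_of_subset_of_nonneg (Finset.range_mono hm) fun _ _ _ ↦ hw _)
    (m := M) (by omega)
  simpa using this

theorem sum_range_gren_le_tangent {m k : ℕ} (hm : m < N) (hk : k ≤ N) :
    ∑ j ∈ Finset.range k, gren N w j ≤
      ∑ j ∈ Finset.range m, gren N w j + gren N w m * (k - m) := by
  rcases le_total m k with h | h
  · rw [← Finset.sum_range_add_sum_Ico _ h]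
    gcongr
    calc ∑ j ∈ Finset.Ico m k, gren N w j ≤ ∑ j ∈ Finset.Ico m k, gren N w m :=
          Finset.sum_le_sum fun j hj ↦ by
            have := Finset.mem_Ico.1 hj
            exact gren_antitoneOn this.1 (by omega)
      _ = _ := by simp [Nat.cast_sub h, mul_comm]
  · rw [← Finset.sum_range_add_sum_Ico _ h, add_assoc]
    refine le_add_of_nonneg_right ?_
    have : ∑ j ∈ Finset.Ico k m, gren N w m ≤ ∑ j ∈ Finset.Ico k m, gren N w j :=
      Finset.sum_le_sum fun j hj ↦ by
        have := Finset.mem_Ico.1 hj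
        exact gren_antitoneOn this.2.le hm
    simp only [Finset.sum_const, Nat.card_Ico, nsmul_eq_mul, Nat.cast_sub h] at this
    linarith

/-- Trailing zeros of a nonnegative vector do not change its least concave majorant. -/
theorem leastConcaveMajorant_of_trailing_zero (hw : ∀ i, 0 ≤ w i) (h0 : ∀ i, N ≤ i → w i = 0)
    (hNK : N ≤ K) {m : ℕ} (hm : m ≤ K) :
    leastConcaveMajorant K (fun m ↦ ∑ i ∈ Finset.range m, w i) m =
      leastConcaveMajorant N (fun m ↦ ∑ i ∈ Finset.range m, w i) (min m N : ℕ) := by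
  have hS : ∀ k, N ≤ k → ∑ i ∈ Finset.range k, w i = ∑ i ∈ Finset.range N, w i := fun k hk ↦
    (Finset.sum_subset (Finset.range_mono hk) fun i _ hi ↦ h0 i (by simpa using hi)).symm
  rcases lt_or_ge m N with h | h
  · rw [min_eq_left h.le]
    apply le_antisymm
    -- The tangent line at m has slope `s ≥ 0`, so it stays above the partial sums beyond N, which
    -- are constant.
    · set s := gren N w m
      set L := leastConcaveMajorant N (fun m ↦ ∑ i ∈ Finset.range m, w i) (m : ℝ)
      have hs : 0 ≤ s := gren_nonneg_of_nonneg hw h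
      have ht : ∀ k ≤ N, ∑ i ∈ Finset.range k, w i ≤ L + s * (k - m) := fun k hk ↦ by
        have h1 := sum_range_gren_le_tangent (w := w) h hk
        rw [sum_range_gren, sum_range_gren] at h1
        exact (le_leastConcaveMajorant (S := fun m ↦ ∑ i ∈ Finset.range m, w i) hk).trans h1
      have := leastConcaveMajorant_le_affine (n := K)
        (S := fun m ↦ ∑ i ∈ Finset.range m, w i) (a := L - s * m) (b := s) (fun k hk ↦ ?_) hm
      · linarith
      · rcases le_total k N with h' | h'
        · linarith [ht k h']
        · rw [hS k h']
          have h2 : (N : ℝ) ≤ k := by exact_mod_cast h'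
          have := ht N le_rfl
          nlinarith
    · refine le_csInf (leastConcaveMajorant_set_nonempty K _ _) ?_
      rintro v ⟨g, hg, hgS, rfl⟩
      refine leastConcaveMajorant_le (hg.subset (Set.Icc_subset_Icc le_rfl ?_) (convex_Icc _ _))
        (fun k hk ↦ hgS k (hk.trans hNK)) h.le
      exact_mod_cast hNK
  · rw [min_eq_right h, leastConcaveMajorant_self]
    apply le_antisymm
    · have := leastConcaveMajorant_le_affine (n := K)
        (S := fun m ↦ ∑ i ∈ Finset.range m, w i) (a := ∑ i ∈ Finset.range N, w i) (b := 0)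
        (fun k _ ↦ ?_) hm
      · simpa using this
      · rw [zero_mul, add_zero]
        rcases le_total k N with h' | h'
        · exact Finset.sum_le_sum_of_subset_of_nonneg (Finset.range_mono h') fun _ _ _ ↦ hw _
        · exact (hS k h').le
    · rw [← hS m h]
      exact le_leastConcaveMajorant (S := fun m ↦ ∑ i ∈ Finset.range m, w i) hm

theorem gren_of_trailing_zero (hw : ∀ i, 0 ≤ w i) (h0 : ∀ i, N ≤ i → w i = 0)
    (hNK : N ≤ K) {j : ℕ} (hj : j < K) : gren K w j = if j < N then gren N w j else 0 := by
  rw [gren_eq, leastConcaveMajorant_of_trailing_zero hw h0 hNK hj,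
    leastConcaveMajorant_of_trailing_zero hw h0 hNK hj.le]
  split_ifs with h
  · rw [gren_eq, min_eq_left h.le, min_eq_left (by omega)]
  · rw [min_eq_right (by omega), min_eq_right (by omega), sub_self]

end Restrict

/-! ### Samples from a uniform mass function -/

section Sample

theorem uniformMass_hasSum_one (y : ℕ) : HasSum (uniformMass y) 1 := by
  have h : HasSum (uniformMass y) (∑ x ∈ Finset.range (y + 1), uniformMass y x) :=
    hasSum_sum_of_ne_finset_zero fun x hx ↦ by
      rw [Finset.mem_range] at hx
      exact if_neg (by omega)
  convert h using 1
  have e : ∀ x ∈ Finset.range (y + 1), uniformMass y x = 1 / ((y : ℝ) + 1) := fun x hx ↦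
    if_pos (by have := Finset.mem_range.1 hx; omega)
  rw [Finset.sum_congr rfl e]
  have : (y : ℝ) + 1 ≠ 0 := by positivity
  simp [this]

theorem uniformMass_nonneg (y x : ℕ) : 0 ≤ uniformMass y x := by
  unfold uniformMass
  split_ifs <;> positivity

theorem isDecreasingPMF_uniformMass (y : ℕ) : IsDecreasingPMF (uniformMass y) where
  nonneg := uniformMass_nonneg y
  hasSum_one := uniformMass_hasSum_one y
  antitone x z hxz := by
    have := uniformMass_nonneg y x
    unfold uniformMass at *
    by_cases h : z ≤ y
    · rw [if_pos h, if_pos (hxz.trans h)]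
    · rw [if_neg h]; exact this

theorem massLaw_singleton (p : ℕ → ℝ) (x : ℕ) : massLaw p {x} = ENNReal.ofReal (p x) := by
  rw [massLaw, Measure.sum_apply _ (measurableSet_singleton x), tsum_eq_single x]
  · simp
  · intro z hz
    simp [hz]

theorem isProbabilityMeasure_massLaw {p : ℕ → ℝ} (hp : IsDecreasingPMF p) :
    IsProbabilityMeasure (massLaw p) := by
  refine ⟨?_⟩
  rw [massLaw, Measure.sum_apply _ MeasurableSet.univ]
  simp only [Measure.smul_apply, measure_univ, smul_eq_mul, mul_one]
  rw [← ENNReal.ofReal_tsum_of_nonneg hp.nonneg hp.hasSum_one.summable, hp.hasSum_one.tsum_eq,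
    ENNReal.ofReal_one]

instance (y : ℕ) : IsProbabilityMeasure (massLaw (uniformMass y)) :=
  isProbabilityMeasure_massLaw (isDecreasingPMF_uniformMass y)

theorem integral_massLaw_uniformMass (y : ℕ) (f : ℕ → ℝ)
    (hf : Integrable f (massLaw (uniformMass y))) :
    ∫ x, f x ∂massLaw (uniformMass y) =
      ∑ x ∈ Finset.range (y + 1), 1 / ((y : ℝ) + 1) * f x := by
  rw [integral_countable hf, tsum_eq_sum (s := Finset.range (y + 1))]
  · refine Finset.sum_congr rfl fun x hx ↦ ?_
    have : x ≤ y := by have := Finset.mem_range.1 hx; omega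
    rw [measureReal_def, massLaw_singleton, ENNReal.toReal_ofReal (uniformMass_nonneg y x),
      uniformMass, if_pos this, smul_eq_mul]
  · intro x hx
    have : ¬ x ≤ y := fun h ↦ hx (Finset.mem_range.2 (by omega))
    rw [measureReal_def, massLaw_singleton, uniformMass, if_neg this]
    simp

theorem map_massLaw_uniformMass (y : ℕ) (σ : PermBelow (y + 1)) :
    MeasurePreserving σ.1.symm (massLaw (uniformMass y)) (massLaw (uniformMass y)) := by
  refine ⟨measurable_of_countable _, Measure.ext_of_singleton fun x ↦ ?_⟩
  rw [Measure.map_apply (measurable_of_countable _) (measurableSet_singleton x)]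
  have : σ.1.symm ⁻¹' {x} = {σ.1 x} := by
    ext z
    simp [Equiv.symm_apply_eq]
  rw [this, massLaw_singleton, massLaw_singleton]
  congr 1
  unfold uniformMass
  by_cases h : x < y + 1
  · have h' := σ.apply_lt h
    rw [if_pos (show x ≤ y by omega), if_pos (show σ.1 x ≤ y by omega)]
  · rw [σ.2 x h]

variable {n : ℕ}

theorem empiricalMass_nonneg (X : Fin n → ℕ) (x : ℕ) : 0 ≤ empiricalMass X x := by
  unfold empiricalMass
  refine div_nonneg (Finset.sum_nonneg fun i _ ↦ ?_) (Nat.cast_nonneg n)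
  split_ifs <;> norm_num

theorem empiricalMass_eq_zero (X : Fin n → ℕ) {x : ℕ} (hx : Finset.univ.sup X + 1 ≤ x) :
    empiricalMass X x = 0 := by
  unfold empiricalMass
  rw [Finset.sum_eq_zero, zero_div]
  intro i _
  have := Finset.le_sup (f := X) (Finset.mem_univ i)
  exact if_neg (by omega)

theorem empiricalMass_le_one (X : Fin n → ℕ) (x : ℕ) : empiricalMass X x ≤ 1 := by
  unfold empiricalMass
  refine div_le_one_of_le₀ ?_ (Nat.cast_nonneg n)
  calc _ ≤ ∑ _i : Fin n, (1 : ℝ) := Finset.sum_le_sum fun i _ ↦ by split_ifs <;> norm_num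
    _ = n := by simp

theorem empiricalMass_comp_symm (X : Fin n → ℕ) (σ : Equiv.Perm ℕ) (x : ℕ) :
    empiricalMass (fun k ↦ σ.symm (X k)) x = empiricalMass X (σ x) := by
  simp [empiricalMass, Equiv.symm_apply_eq]

/-- Relabelling the observations by σ⁻¹ preserves the uniform product law and permutes the empirical
mass function by σ. -/
theorem isExchangeableBelow_empiricalMass (y n : ℕ) (c : ℝ) :
    IsExchangeableBelow (fun x (X : Fin n → ℕ) ↦ empiricalMass X x - c) (y + 1)
      (Measure.pi fun _ ↦ massLaw (uniformMass y)) := by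
  intro σ
  have hT := measurePreserving_pi (fun _ : Fin n ↦ massLaw (uniformMass y))
    (fun _ : Fin n ↦ massLaw (uniformMass y)) fun _ ↦ map_massLaw_uniformMass y σ
  have hg : Measurable fun (X : Fin n → ℕ) (i : Fin (y + 1)) ↦ empiricalMass X i - c :=
    measurable_of_countable _
  refine ⟨(measurable_of_countable _).aemeasurable, hg.aemeasurable, ?_⟩
  have e : (fun (X : Fin n → ℕ) (i : Fin (y + 1)) ↦ empiricalMass X (σ.1 i) - c) =
      (fun (X : Fin n → ℕ) (i : Fin (y + 1)) ↦ empiricalMass X i - c) ∘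
        fun X k ↦ σ.1.symm (X k) := by
    ext X i
    simp only [Function.comp, empiricalMass_comp_symm]
  rw [e, ← Measure.map_map hg hT.measurable, hT.map_eq]

theorem memLp_empiricalMass (y n : ℕ) (c : ℝ) (x : ℕ) :
    MemLp (fun X : Fin n → ℕ ↦ empiricalMass X x - c) 2
      (Measure.pi fun _ ↦ massLaw (uniformMass y)) := by
  refine MemLp.of_bound (measurable_of_countable _).aestronglyMeasurable (1 + |c|)
    (ae_of_all _ fun X ↦ (norm_sub_le _ _).trans ?_)
  rw [Real.norm_of_nonneg (empiricalMass_nonneg X x), Real.norm_eq_abs]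
  gcongr
  exact empiricalMass_le_one X x

/-- This is a binomial variance: n times the partial sum of the empirical masses counts the
observations below m, each of which lies there with probability mθ. -/
theorem integral_sum_empiricalMass_sq (y : ℕ) {n : ℕ} (hn : 0 < n) {m : ℕ} (hm : m ≤ y + 1) :
    ∫ X : Fin n → ℕ, (∑ x ∈ Finset.range m, (empiricalMass X x - 1 / ((y : ℝ) + 1))) ^ 2
        ∂(Measure.pi fun _ ↦ massLaw (uniformMass y)) =
      1 / n * (m * (1 / ((y : ℝ) + 1)) - (m * (1 / ((y : ℝ) + 1))) ^ 2) := by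
  set θ : ℝ := 1 / ((y : ℝ) + 1)
  have hθ : ((y : ℝ) + 1) * θ = 1 := by simp only [θ]; field_simp
  have hn' : (n : ℝ) ≠ 0 := by positivity
  set ν := massLaw (uniformMass y)
  -- The contribution of a single observation.
  let h : ℕ → ℝ := fun k ↦ ((if k < m then 1 else 0) - m * θ) / n
  have hsum : ∀ X : Fin n → ℕ, ∑ x ∈ Finset.range m, (empiricalMass X x - θ) =
      (∑ k : Fin n, fun X : Fin n → ℕ ↦ h (X k)) X := by
    intro X
    rw [Finset.sum_apply]
    simp only [h, empiricalMass, Finset.sum_sub_distrib, ← Finset.sum_div]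
    rw [Finset.sum_comm, sub_div]
    congr 1
    · congr 1
      refine Finset.sum_congr rfl fun k _ ↦ ?_
      rw [Finset.sum_ite_eq]
      simp
    · simp only [Finset.sum_const, Finset.card_range, Finset.card_univ, Fintype.card_fin,
        nsmul_eq_mul]
      field_simp
  have hb : ∀ k, |h k| ≤ (1 + |m * θ|) / n := by
    intro k
    simp only [h, abs_div, Nat.abs_cast]
    gcongr
    refine (abs_sub _ _).trans ?_
    gcongr
    split_ifs <;> simp
  have hL : MemLp h 2 ν := MemLp.of_bound (measurable_of_countable _).aestronglyMeasurable _
    (ae_of_all _ hb)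
  have hcount : ∑ x ∈ Finset.range (y + 1), (if x < m then (1 : ℝ) else 0) = m := by
    rw [← Finset.sum_filter]
    have : (Finset.range (y + 1)).filter (· < m) = Finset.range m := by
      ext z; simp only [Finset.mem_filter, Finset.mem_range]; omega
    simp [this]
  have hmean : ∫ k, h k ∂ν = 0 := by
    rw [integral_massLaw_uniformMass y h (hL.integrable (by norm_num)), ← Finset.mul_sum]
    simp only [h, ← Finset.sum_div, Finset.sum_sub_distrib, hcount]
    simp only [Finset.sum_const, Finset.card_range, nsmul_eq_mul]
    push_cast
    have : (m : ℝ) - (y + 1) * (m * θ) = 0 := by linear_combination -(m : ℝ) * hθ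
    rw [this, zero_div, mul_zero]
  have hvar : Var[h; ν] = (m * θ - (m * θ) ^ 2) / n ^ 2 := by
    rw [variance_of_integral_eq_zero hL.aemeasurable hmean,
      integral_massLaw_uniformMass y _ hL.integrable_sq, ← Finset.mul_sum]
    have e : ∀ x, h x ^ 2 =
        ((if x < m then 1 else 0) * (1 - 2 * (m * θ)) + (m * θ) ^ 2) / n ^ 2 := by
      intro x
      simp only [h]
      split_ifs <;> ring
    simp_rw [e]
    rw [← Finset.sum_div, Finset.sum_add_distrib, ← Finset.sum_mul, hcount]
    simp only [Finset.sum_const, Finset.card_range, nsmul_eq_mul]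
    push_cast
    rw [mul_div_assoc']
    congr 1
    change θ * _ = _
    linear_combination (m * θ) ^ 2 * hθ
  have hint : ∫ X : Fin n → ℕ, (∑ k : Fin n, fun X : Fin n → ℕ ↦ h (X k)) X
      ∂Measure.pi (fun _ ↦ ν) = 0 := by
    simp_rw [Finset.sum_apply]
    have hi : ∀ k : Fin n, Integrable (fun X : Fin n → ℕ ↦ h (X k)) (Measure.pi fun _ ↦ ν) :=
      fun k ↦ (hL.comp_measurePreserving
        (measurePreserving_eval (fun _ : Fin n ↦ ν) k)).integrable (by norm_num)
    rw [integral_finsetSum _ fun k _ ↦ hi k]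
    refine Finset.sum_eq_zero fun k _ ↦ ?_
    have hk := measurePreserving_eval (fun _ : Fin n ↦ ν) k
    have e := integral_map (μ := Measure.pi fun _ : Fin n ↦ ν) hk.measurable.aemeasurable
      (measurable_of_countable h).aestronglyMeasurable
    rw [hk.map_eq, hmean] at e
    exact e.symm
  simp_rw [hsum]
  rw [← variance_of_integral_eq_zero (measurable_of_countable _).aemeasurable hint,
    variance_sum_pi fun _ ↦ hL]
  simp only [hvar, Finset.sum_const, Finset.card_univ, Fintype.card_fin, nsmul_eq_mul]
  field_simp

/-- The estimator uses the random length max X + 1. The empirical masses beyond it vanish, so the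
fixed length y + 1 gives the same slopes. -/
theorem grenanderEstimator_eq {y : ℕ} {X : Fin n → ℕ} (hX : ∀ k, X k ≤ y) {x : ℕ} (hx : x ≤ y) :
    grenanderEstimator X x = gren (y + 1) (empiricalMass X) x := by
  have hM : Finset.univ.sup X + 1 ≤ y + 1 := by
    have : Finset.univ.sup X ≤ y := Finset.sup_le fun k _ ↦ hX k
    omega
  rw [gren_of_trailing_zero (empiricalMass_nonneg X) (fun i hi ↦ empiricalMass_eq_zero X hi) hM
    (by omega), grenanderEstimator]
  simp only [Nat.lt_add_one_iff]

theorem tsum_grenanderEstimator_sub_sq {y : ℕ} {X : Fin n → ℕ} (hX : ∀ k, X k ≤ y) :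
    ∑' x, (grenanderEstimator X x - uniformMass y x) ^ 2 =
      ∑ x ∈ Finset.range (y + 1),
        gren (y + 1) (fun i ↦ empiricalMass X i - 1 / ((y : ℝ) + 1)) x ^ 2 := by
  rw [tsum_eq_sum (s := Finset.range (y + 1))]
  · refine Finset.sum_congr rfl fun x hx ↦ ?_
    have hx := Finset.mem_range.1 hx
    rw [grenanderEstimator_eq hX (by omega), gren_sub_const _ _ _ hx, uniformMass,
      if_pos (by omega)]
  · intro x hx
    have hx : ¬ x ≤ y := fun h ↦ hx (Finset.mem_range.2 (by omega))
    have hM : Finset.univ.sup X ≤ y := Finset.sup_le fun k _ ↦ hX k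
    rw [grenanderEstimator, uniformMass, if_neg hx, if_neg (by omega)]
    simp

theorem ae_le_of_uniformMass (y n : ℕ) :
    ∀ᵐ X : Fin n → ℕ ∂Measure.pi fun _ ↦ massLaw (uniformMass y), ∀ k, X k ≤ y := by
  have h : ∀ᵐ x ∂massLaw (uniformMass y), x ≤ y := by
    rw [ae_iff, massLaw, Measure.sum_apply _ (MeasurableSet.of_discrete)]
    simp only [Measure.smul_apply, smul_eq_mul, ENNReal.tsum_eq_zero]
    intro x
    by_cases hx : x ≤ y
    · simp [hx]
    · simp [uniformMass, hx]
  rw [ae_all_iff]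
  intro k
  exact (measurePreserving_eval (fun _ : Fin n ↦ massLaw (uniformMass y))
    k).quasiMeasurePreserving.ae h

/-- The y + 1 subtracted terms 1/(y + 1) cancel the term j = 1 of the harmonic sum. -/
theorem sum_uniform_eq (y : ℕ) :
    ∑ j ∈ Finset.Icc 1 (y + 1), 1 / ((y : ℝ) + 1) * (1 / (j : ℝ) - 1 / ((y : ℝ) + 1)) =
      1 / ((y : ℝ) + 1) * ∑ i ∈ Finset.Icc 1 y, 1 / ((i : ℝ) + 1) := by
  have hy : (y : ℝ) + 1 ≠ 0 := by positivity
  rw [← Finset.mul_sum, Finset.sum_sub_distrib, ← Finset.Ico_add_one_right_eq_Icc,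
    Finset.sum_eq_sum_Ico_succ_bot (by omega), ← Finset.Ico_add_one_right_eq_Icc]
  have : ∑ k ∈ Finset.Ico (1 + 1) (y + 1 + 1), 1 / (k : ℝ) =
      ∑ k ∈ Finset.Ico 1 (y + 1), 1 / ((k : ℝ) + 1) := by
    rw [← Finset.sum_Ico_add' (fun k : ℕ ↦ 1 / (k : ℝ))]
    simp
  rw [this]
  simp only [Finset.sum_const, Nat.card_Ico, nsmul_eq_mul, Nat.add_sub_cancel]
  congr 1
  push_cast
  field_simp
  ring

/-- The risk of the Grenander estimator under a uniform mass function. -/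
theorem grenanderRisk_uniformMass (y : ℕ) {n : ℕ} (hn : 0 < n) :
    n * grenanderRisk (uniformMass y) n =
      1 / ((y : ℝ) + 1) * ∑ i ∈ Finset.Icc 1 y, 1 / ((i : ℝ) + 1) := by
  have hX := fun i (_ : i < y + 1) ↦ memLp_empiricalMass y n (1 / ((y : ℝ) + 1)) i
  have hexch := isExchangeableBelow_empiricalMass y n (1 / ((y : ℝ) + 1))
  have h := hexch.sum_integral_gren_sq hX fun m hm ↦ integral_sum_empiricalMass_sq y hn hm
  rw [← integral_finsetSum _ fun j hj ↦
    (hexch.integral_gren_sq hX).1 j (Finset.mem_range.1 hj)] at h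
  rw [grenanderRisk, ← sum_uniform_eq]
  rw [integral_congr_ae ((ae_le_of_uniformMass y n).mono fun X hX ↦
    tsum_grenanderEstimator_sub_sq hX), h, ← mul_assoc, mul_one_div_cancel (by positivity), one_mul]

end Sample

/-! ### The constant a_y and its asymptotics -/

section Uniform

theorem isConstancyDecomposition_uniformMass (y : ℕ) :
    IsConstancyDecomposition (uniformMass y) {i | i < 2}
      (fun i ↦ if i = 0 then Set.Iio (y + 1) else Set.Ici (y + 1))
      (fun i ↦ if i = 0 then 1 / ((y : ℝ) + 1) else 0) where
  isLowerSet := fun i j hij (hi : i < 2) ↦ lt_of_le_of_lt hij hi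
  nonempty i _ := by
    by_cases h : i = 0
    · simp only [h, if_true]; exact ⟨0, by simp⟩
    · simp only [h, if_false]; exact ⟨y + 1, by simp⟩
  disjoint i hi j hj hij := by
    have hi : i < 2 := hi
    have hj : j < 2 := hj
    rw [Function.onFun, Set.disjoint_left]
    intro x
    interval_cases i <;> interval_cases j <;> simp at hij ⊢
  cover := by
    ext x
    simp only [Set.mem_iUnion, Set.mem_univ, iff_true]
    by_cases h : x < y + 1
    · exact ⟨0, by simp, by simpa using h⟩
    · exact ⟨1, by simp, by simpa using h⟩
  value i hi x hx := by
    have hi : i < 2 := hi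
    interval_cases i
    · simp at hx
      simp [uniformMass, show x ≤ y by omega]
    · simp at hx
      simp [uniformMass, show ¬ x ≤ y by omega]
  strictAnti i hi := by
    have hi : i + 1 < 2 := hi
    obtain rfl : i = 0 := by omega
    simp only [if_true]
    rw [if_neg (by norm_num)]
    positivity

theorem integral_tsum_grenTransform_uniformMass_sq {Ω : Type*} [MeasurableSpace Ω] {P : Measure Ω}
    [IsProbabilityMeasure P] {Y : ℕ → Ω → ℝ} {y : ℕ} (hY : IsLimitProcess (uniformMass y) Y P) :
    ∫ ω, ∑' x, grenTransform (uniformMass y) (Y · ω) x ^ 2 ∂P =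
      1 / ((y : ℝ) + 1) * ∑ i ∈ Finset.Icc 1 y, 1 / ((i : ℝ) + 1) := by
  have h := (hasSum_integral_tsum_grenTransform_sq (isDecreasingPMF_uniformMass y) hY
    (isConstancyDecomposition_uniformMass y)).2.2
  refine h.unique ?_
  rw [← sum_uniform_eq]
  convert hasSum_single (⟨0, by simp⟩ : {i : ℕ | i < 2}) fun i hi ↦ ?_ using 1
  · have : (Set.Iio (y + 1)).ncard = y + 1 := by
      rw [← Finset.coe_Iio, Set.ncard_coe_finset, Nat.card_Iio]
    simp [this]
  · have : (i : ℕ) ≠ 0 := fun h0 ↦ hi (Subtype.ext h0)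
    simp [this]

/-- The sum is the harmonic number of y + 1 minus 1, which differs from log y by a bounded amount,
and log y tends to infinity. -/
theorem isEquivalent_log :
    (fun y : ℕ ↦ 1 / ((y : ℝ) + 1) * ∑ i ∈ Finset.Icc 1 y, 1 / ((i : ℝ) + 1)) ~[atTop]
      fun y : ℕ ↦ Real.log y / ((y : ℝ) + 1) := by
  have h : (fun y : ℕ ↦ ∑ i ∈ Finset.Icc 1 y, 1 / ((i : ℝ) + 1)) ~[atTop]
      fun y : ℕ ↦ Real.log y := by
    have e : ∀ y : ℕ, ∑ i ∈ Finset.Icc 1 y, 1 / ((i : ℝ) + 1) =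
        harmonic y + (1 / ((y : ℝ) + 1) - 1) := by
      intro y
      induction y with
      | zero => simp
      | succ y ih =>
        rw [Finset.sum_Icc_succ_top (by omega), ih, harmonic_succ]
        push_cast
        ring
    have hl : Tendsto (fun y : ℕ ↦ (harmonic y : ℝ) - Real.log y + (1 / ((y : ℝ) + 1) - 1)) atTop
        (𝓝 (Real.eulerMascheroniConstant + (0 - 1))) :=
      Real.tendsto_harmonic_sub_log.add
        ((tendsto_one_div_add_atTop_nhds_zero_nat (𝕜 := ℝ)).sub_const 1)
    have hlog : Tendsto (fun y : ℕ ↦ Real.log y) atTop atTop :=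
      Real.tendsto_log_atTop.comp tendsto_natCast_atTop_atTop
    refine IsBigO.trans_isLittleO (g := fun _ ↦ (1 : ℝ)) ?_
      ((isLittleO_const_left.2 (Or.inr (tendsto_norm_atTop_atTop.comp hlog))))
    refine (hl.isBigO_one ℝ).congr_left fun y ↦ ?_
    simp only [Pi.sub_apply, e]
    ring
  have := (IsEquivalent.refl (u := fun y : ℕ ↦ 1 / ((y : ℝ) + 1)) (l := atTop)).mul h
  refine this.congr_right (Eventually.of_forall fun y ↦ ?_)
  simp only [Pi.mul_apply]
  ring

end Uniform

theorem mainTheorem3 :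
    -- the formulas for a general decreasing mass function
    (∀ (Ω : Type*) [MeasurableSpace Ω] (P : Measure Ω) [IsProbabilityMeasure P]
        (p : ℕ → ℝ) (Y : ℕ → Ω → ℝ) (I : Set ℕ) (C : ℕ → Set ℕ) (θ : ℕ → ℝ),
        IsDecreasingPMF p → IsLimitProcess p Y P → IsConstancyDecomposition p I C θ →
        -- the squared `ℓ²` norm; `C i` is infinite only if `θ i = 0`, when its term is zero
        ((∀ᵐ ω ∂P, Summable fun x ↦ grenTransform p (Y · ω) x ^ 2) ∧
          Integrable (fun ω ↦ ∑' x, grenTransform p (Y · ω) x ^ 2) P ∧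
          HasSum (fun i : I ↦ ∑ j ∈ Finset.Icc 1 (C i).ncard, θ i * (1 / (j : ℝ) - θ i))
            (∫ ω, ∑' x, grenTransform p (Y · ω) x ^ 2 ∂P)) ∧
        -- the Hellinger-type functional, when the support of `p` is `{0, …, κ}`
        (∀ κ : ℕ, IsGreatest {x | 0 < p x} κ →
          Integrable (fun ω ↦ ∑ x ∈ Finset.range (κ + 1), grenTransform p (Y · ω) x ^ 2 / p x) P ∧
          HasSum (fun i : {i // i ∈ I ∧ 0 < θ i} ↦
              ∑ j ∈ Finset.Icc 1 (C i).ncard, (1 / (j : ℝ) - θ i))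
            (∫ ω, ∑ x ∈ Finset.range (κ + 1), grenTransform p (Y · ω) x ^ 2 / p x ∂P))) ∧
    -- the asymptotic risk of the maximum likelihood estimator under a uniform mass function
    (∃ a : ℕ → ℝ,
      (∀ y, a y = 1 / ((y : ℝ) + 1) * ∑ i ∈ Finset.Icc 1 y, 1 / ((i : ℝ) + 1)) ∧
      (∀ y, Tendsto (fun n : ℕ ↦ (n : ℝ) * grenanderRisk (uniformMass y) n) atTop (𝓝 (a y))) ∧
      (∀ (Ω : Type*) [MeasurableSpace Ω] (P : Measure Ω) [IsProbabilityMeasure P]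
        (Y : ℕ → Ω → ℝ) (y : ℕ), IsLimitProcess (uniformMass y) Y P →
        ∫ ω, ∑' x, grenTransform (uniformMass y) (Y · ω) x ^ 2 ∂P = a y) ∧
      a ~[atTop] fun y : ℕ ↦ Real.log y / ((y : ℝ) + 1)) := by
  refine ⟨fun Ω _ P _ p Y I C θ hp hY hC ↦ ⟨hasSum_integral_tsum_grenTransform_sq hp hY hC,
    fun κ hκ ↦ hasSum_integral_sum_grenTransform_sq_div hp hY hC hκ⟩,
    fun y ↦ 1 / ((y : ℝ) + 1) * ∑ i ∈ Finset.Icc 1 y, 1 / ((i : ℝ) + 1), fun _ ↦ rfl, fun y ↦ ?_,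
    fun Ω _ P _ Y y hY ↦ integral_tsum_grenTransform_uniformMass_sq hY, isEquivalent_log⟩
  -- The sequence is constant from n = 1 on.
  refine tendsto_const_nhds.congr' ?_
  filter_upwards [eventually_gt_atTop 0] with n hn
  exact (grenanderRisk_uniformMass y hn).symm
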